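/- **Theorem (Quantum Conditional Jensen's Inequality).** Let $\mathcal H$ be a finite-dimensional complex Hilbert space of dimension $d\ge 1$, let $X$ be a locally compact Hausdorff space with Borel $\sigma$-algebra $\mathcal B(X)$, and let $\nu$ be a quantum probability measure on $X$: a $\sigma$-additive map $\nu:\mathcal B(X)\to\mathcal B(\mathcal H)$ with positive values and $\nu(X)=1$. Let $\mathcal F\subseteq\mathcal B(X)$ be a sub-$\sigma$-algebra and $\nu'=\nu|_{\mathcal F}$. *Definitions.* A function $\psi:X\to\mathcal B(\mathcal H)$ is measurable (a quantum random variable) with respect to a $\sigma$-algebra if $x\mapsto\operatorname{tr}(\rho\,\psi(x))$ is measurable with respect to it for every state $\rho$ (positive operator of trace $1$). For a positive operator valued measure $\kappa$ on a $\sigma$-algebra $\mathcal A$ of subsets of $X$ let $\mu_\kappa=\frac1d\operatorname{tr}\circ\kappa$, let $\frac{d\kappa}{d\mu_\kappa}$ be the ($\mathcal A$-measurable, entrywise) Radon–Nikodým derivative, and for $\mathcal A$-measurable $\psi$ put $\psi_\rho=\operatorname{tr}\bigl(\rho(\tfrac{d\kappa}{d\mu_\kappa})^{1/2}\psi(\tfrac{d\kappa}{d\mu_\kappa})^{1/2}\bigr)$.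 The function $\psi$ is $\kappa$-integrable if every $\psi_\rho$ is $\mu_\kappa$-integrable, and then $\int_X\psi\,d\kappa$ is the operator with $\operatorname{tr}(\rho\int_X\psi\,d\kappa)=\int_X\psi_\rho\,d\mu_\kappa$ for all states $\rho$. A version of $\mathbb E_\nu[\psi|\mathcal F]$ is an $\mathcal F$-measurable, $\nu'$-integrable $\varphi:X\to\mathcal B(\mathcal H)$ such that for every $E\in\mathcal F$ the integrals $\int_X\varphi\chi_E\,d\nu'$ and $\int_X\psi\chi_E\,d\nu$ exist and are equal. A function $\vartheta:J\to\mathbb R$ on an interval $J$ is operator convex if $\vartheta(ta+(1-t)b)\le t\vartheta(a)+(1-t)\vartheta(b)$ for all $t\in[0,1]$ and all selfadjoint complex matrices $a,b$ of the same (arbitrary) size with spectra in $J$. *Statement.* Let $J\subseteq\mathbb R$ be an open interval containing $[\alpha,\beta]$, $\alpha\le\beta$, let $\psi:X\to\mathcal B(\mathcal H)$ be a (Borel) quantum random variable such that every $\psi(x)$ is selfadjoint with spectrum in $[\alpha,\beta]$, and let $\vartheta:J\to\mathbb R$ be operator convex. Then versions of $\mathbb E_\nu[\psi|\mathcal F]$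 and of $\mathbb E_\nu[\vartheta(\psi)|\mathcal F]$ exist, and for all versions $\varphi$ of $\mathbb E_\nu[\psi|\mathcal F]$ and $\omega$ of $\mathbb E_\nu[\vartheta(\psi)|\mathcal F]$: 1. for $\nu$-almost every $x$, if $\varphi_K$, $\omega_K$ denote the compressions of $\varphi(x)$, $\omega(x)$ to the range $K$ of $\frac{d\nu'}{d\mu_{\nu'}}(x)$, then $\varphi_K$ is selfadjoint with spectrum in $[\alpha,\beta]$ and $\omega_K\ge\vartheta(\varphi_K)$; 2. for $\nu$-almost every $x$ at which $\frac{d\nu'}{d\mu_{\nu'}}(x)$ is invertible, $\varphi(x)$ is selfadjoint with spectrum in $[\alpha,\beta]$ and $\omega(x)\ge\vartheta(\varphi(x))$. In particular, if $\frac{d\nu'}{d\mu_{\nu'}}$ is invertible $\nu$-almost everywhere, then $\mathbb E_\nu[\vartheta(\psi)|\mathcal F]\ge\vartheta\bigl(\mathbb E_\nu[\psi|\mathcal F]\bigr)$ $\nu$-almost everywhere. -/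

import Mathlib

open MeasureTheory Set

noncomputable section

namespace QuantumProb

variable {X : Type*} {H : Type*} [NormedAddCommGroup H] [InnerProductSpace ℂ H]
  [FiniteDimensional ℂ H]

/-- The canonical trace functional on the operators of a finite-dimensional Hilbert space. -/
def tr (a : H →L[ℂ] H) : ℂ := LinearMap.trace ℂ H (a : H →ₗ[ℂ] H)

/-- States (density operators): positive operators of trace one. -/
def IsState (ρ : H →L[ℂ] H) : Prop := 0 ≤ ρ ∧ tr ρ = 1

/-- An operator-valued function `ψ` is a quantum random variable with respect to the σ-algebra `m`
if `x ↦ tr (ρ ψ(x))` is `m`-measurable for every state `ρ`. -/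
def IsQRV (m : MeasurableSpace X) (ψ : X → H →L[ℂ] H) : Prop :=
  ∀ ρ : H →L[ℂ] H, IsState ρ → Measurable[m] fun x => tr (ρ * ψ x)

variable (H) in
/-- A positive operator valued measure on `(X, m)`. The space `H` is finite-dimensional, so
countable additivity in the norm topology, which is what a vector measure has, is countable
additivity in the σ-weak topology. -/
structure POVM (m : MeasurableSpace X) where
  toVectorMeasure : VectorMeasure X (H →L[ℂ] H)
  nonneg : ∀ E, MeasurableSet E → 0 ≤ toVectorMeasure E
  univ_ne_zero : toVectorMeasure univ ≠ 0

namespace POVM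

variable {m : MeasurableSpace X}

/-- `ν` is a quantum probability measure if `ν(X) = 1`. -/
def IsProbability (ν : POVM H m) : Prop := ν.toVectorMeasure univ = 1

/-- The restriction of a positive operator valued measure to a sub-σ-algebra. -/
def restrict (ν : POVM H m) {F : MeasurableSpace X} (hF : F ≤ m) : POVM H F where
  toVectorMeasure := ν.toVectorMeasure.trim hF
  nonneg E hE := by
    rw [VectorMeasure.trim_measurableSet_eq hF hE]
    exact ν.nonneg E (hF E hE)
  univ_ne_zero := by
    rw [VectorMeasure.trim_measurableSet_eq hF (@MeasurableSet.univ X F)]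
    exact ν.univ_ne_zero

/-- The functional `a ↦ re (tr a) / d`, where `d = dim H`. -/
def normTr : (H →L[ℂ] H) →ₗ[ℝ] ℝ where
  toFun a := (tr a).re / Module.finrank ℂ H
  map_add' a b := by simp [tr, add_div]
  map_smul' r a := by
    have : ((r • a : H →L[ℂ] H) : H →ₗ[ℂ] H) = (r : ℂ) • (a : H →ₗ[ℂ] H) := by
      ext x; simp
    simp [tr, this, mul_div_assoc]

/-- The real-valued set function `E ↦ tr (ν E) / d`. -/
def traceMeasure (ν : POVM H m) : SignedMeasure X :=
  ν.toVectorMeasure.mapRange (normTr (H := H)).toAddMonoidHom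
    (LinearMap.continuous_of_finiteDimensional (normTr (H := H)))

lemma traceMeasure_nonneg (ν : POVM H m) : 0 ≤[univ] ν.traceMeasure := by
  refine VectorMeasure.restrict_le_restrict_of_subset_le _ _ fun E hE _ => ?_
  have h := ContinuousLinearMap.nonneg_iff_isPositive _ |>.1 (ν.nonneg E hE)
  have h' := (Complex.le_def.1 h.toLinearMap.trace_nonneg).1
  change (0 : ℝ) ≤ _ / _
  exact div_nonneg h' (Nat.cast_nonneg _)

/-- The finite measure `μ(E) = tr (ν E) / d` induced by `ν`. -/
def inducedMeasure (ν : POVM H m) : Measure X :=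
  ν.traceMeasure.toMeasureOfZeroLE univ MeasurableSet.univ ν.traceMeasure_nonneg

lemma inducedMeasure_apply (ν : POVM H m) {E : Set X} (hE : MeasurableSet E) :
    ν.inducedMeasure E =
      ENNReal.ofReal ((tr (ν.toVectorMeasure E)).re / Module.finrank ℂ H) := by
  have h0 : (0 : ℝ) ≤ ν.traceMeasure E := by
    simpa using VectorMeasure.subset_le_of_restrict_le_restrict _ _ MeasurableSet.univ
      ν.traceMeasure_nonneg (subset_univ E)
  change _ = ENNReal.ofReal (ν.traceMeasure E)
  rw [inducedMeasure, SignedMeasure.toMeasureOfZeroLE_apply _ _ _ hE, ENNReal.ofReal,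
    Real.toNNReal_of_nonneg h0]
  simp only [univ_inter]

instance (ν : POVM H m) : IsFiniteMeasure ν.inducedMeasure := by
  unfold inducedMeasure; infer_instance

/-- The matrix entry `E ↦ ⟨e i, ν(E) (e j)⟩` of `ν` in an orthonormal basis `e` of `H`. -/
def entry (ν : POVM H m) (i j : Fin (Module.finrank ℂ H)) : ComplexMeasure X :=
  ν.toVectorMeasure.mapRange
    { toFun := fun a => inner ℂ (stdOrthonormalBasis ℂ H i) (a (stdOrthonormalBasis ℂ H j))
      map_zero' := by simp
      map_add' := by simp }
    (by
      change Continuous fun a : H →L[ℂ] H =>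
        inner ℂ (stdOrthonormalBasis ℂ H i) (a (stdOrthonormalBasis ℂ H j))
      fun_prop)

/-- The principal Radon–Nikodým derivative `dν/dμ` of `ν` with respect to its induced measure `μ`:
the operator whose matrix entries are the scalar Radon–Nikodým derivatives of the matrix entries
of `ν`. -/
def density (ν : POVM H m) (x : X) : H →L[ℂ] H :=
  ∑ i, ∑ j, (ν.entry i j).rnDeriv ν.inducedMeasure x •
    InnerProductSpace.rankOne ℂ (stdOrthonormalBasis ℂ H i) (stdOrthonormalBasis ℂ H j)

lemma eq_zero_of_tr (a : H →L[ℂ] H) (ha : 0 ≤ a) (h : (tr a).re / Module.finrank ℂ H = 0) : a = 0 := by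
  have h1 := ContinuousLinearMap.nonneg_iff_isPositive _ |>.1 ha
  have h2 := Complex.le_def.1 h1.toLinearMap.trace_nonneg
  have h3 : tr a = 0 := by
    rcases div_eq_zero_iff.1 h with h | h
    · exact Complex.ext h h2.2.symm
    · have : Module.finrank ℂ H = 0 := by exact_mod_cast h
      have := Module.finrank_zero_iff.1 this
      have : a = 0 := by ext x; exact Subsingleton.elim _ _
      simp [this, tr]
  have hp := LinearMap.posSemidef_toMatrix_iff (stdOrthonormalBasis ℂ H) |>.mpr h1.toLinearMap
  have : (a : H →ₗ[ℂ] H).toMatrix (stdOrthonormalBasis ℂ H).toBasis (stdOrthonormalBasis ℂ H).toBasis = 0 := by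
    apply hp.trace_eq_zero_iff.1
    rw [← LinearMap.trace_eq_matrix_trace]; exact h3
  have : (a : H →ₗ[ℂ] H) = 0 := by simpa using this
  ext x; exact congrArg (fun f : H →ₗ[ℂ] H => f x) this

lemma eq_zero_of_inducedMeasure (ν : POVM H m) {E : Set X} (hE : MeasurableSet E) (h : ν.inducedMeasure E = 0) :
    ν.toVectorMeasure E = 0 := by
  rw [inducedMeasure_apply ν hE, ENNReal.ofReal_eq_zero] at h
  apply eq_zero_of_tr _ (ν.nonneg E hE)
  have h1 := ContinuousLinearMap.nonneg_iff_isPositive _ |>.1 (ν.nonneg E hE)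
  exact le_antisymm h (div_nonneg (Complex.le_def.1 h1.toLinearMap.trace_nonneg).1 (Nat.cast_nonneg _))

lemma entry_spec (ν : POVM H m) (i j) (E : Set X) (hE : MeasurableSet E) :
    ν.entry i j E = ∫ x in E, (ν.entry i j).rnDeriv ν.inducedMeasure x ∂ν.inducedMeasure := by
  have key : ∀ s : Set X, MeasurableSet s → ν.inducedMeasure s = 0 → ν.entry i j s = 0 := by
    intro s hs h
    simp [entry, eq_zero_of_inducedMeasure ν hs h]
  have hre : (ν.entry i j).re ≪ᵥ ν.inducedMeasure.toENNRealVectorMeasure := by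
    apply VectorMeasure.AbsolutelyContinuous.mk
    intro s hs h
    rw [Measure.toENNRealVectorMeasure_apply_measurable hs] at h
    change (ν.entry i j s).re = 0
    simp [key s hs h]
  have him : (ν.entry i j).im ≪ᵥ ν.inducedMeasure.toENNRealVectorMeasure := by
    apply VectorMeasure.AbsolutelyContinuous.mk
    intro s hs h
    rw [Measure.toENNRealVectorMeasure_apply_measurable hs] at h
    change (ν.entry i j s).im = 0
    simp [key s hs h]
  have e1 := SignedMeasure.withDensityᵥ_rnDeriv_eq _ _ hre
  have e2 := SignedMeasure.withDensityᵥ_rnDeriv_eq _ _ him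
  have e1' := congrArg (fun v => v E) e1
  have e2' := congrArg (fun v => v E) e2
  rw [withDensityᵥ_apply (SignedMeasure.integrable_rnDeriv _ _) hE] at e1' e2'
  have hint := (ComplexMeasure.integrable_rnDeriv (ν.entry i j) ν.inducedMeasure).restrict (s := E)
  apply Complex.ext
  · have := integral_re (𝕜 := ℂ) hint
    simp only [RCLike.re_to_complex] at this
    rw [← this]; exact e1'.symm
  · have := integral_im (𝕜 := ℂ) hint
    simp only [RCLike.im_to_complex] at this
    rw [← this]; exact e2'.symm

/-- `ν(E) = ∫_E (dν/dμ) dμ`. -/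
lemma density_spec (ν : POVM H m) (E : Set X) (hE : MeasurableSet E) :
    ν.toVectorMeasure E = ∫ x in E, ν.density x ∂ν.inducedMeasure := by
  have hint : ∀ i j, Integrable ((ν.entry i j).rnDeriv ν.inducedMeasure) (ν.inducedMeasure.restrict E) :=
    fun i j => (ComplexMeasure.integrable_rnDeriv (ν.entry i j) ν.inducedMeasure).restrict (s := E)
  unfold density
  rw [integral_finsetSum _ (fun i _ => integrable_finsetSum _ fun j _ => (hint i j).smul_const _)]
  simp_rw [fun i => integral_finsetSum (μ := ν.inducedMeasure.restrict E) Finset.univ (fun j _ => (hint i j).smul_const (InnerProductSpace.rankOne ℂ (stdOrthonormalBasis ℂ H i) (stdOrthonormalBasis ℂ H j))), integral_smul_const, ← entry_spec ν _ _ E hE]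
  apply ContinuousLinearMap.coe_injective
  apply (stdOrthonormalBasis ℂ H).toBasis.ext
  intro k
  simp [entry, orthonormal_iff_ite.1 (stdOrthonormalBasis ℂ H).orthonormal,
    OrthonormalBasis.sum_repr']

end POVM

variable [CompleteSpace H] {m : MeasurableSpace X}

/-- The function `ψ_ρ(x) = tr (ρ (dν/dμ)^{1/2} ψ(x) (dν/dμ)^{1/2})`. -/
def scalarized (ν : POVM H m) (ψ : X → H →L[ℂ] H) (ρ : H →L[ℂ] H) (x : X) : ℂ :=
  tr (ρ * CFC.sqrt (ν.density x) * ψ x * CFC.sqrt (ν.density x))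

/-- `ψ` is a `ν`-integrable quantum random variable. -/
def IsQIntegrable (ν : POVM H m) (ψ : X → H →L[ℂ] H) : Prop :=
  IsQRV m ψ ∧ ∀ ρ : H →L[ℂ] H, IsState ρ → Integrable (scalarized ν ψ ρ) ν.inducedMeasure

/-- `ψ` is `ν`-integrable and `∫ ψ dν = a`, that is, `a` is the operator satisfying
`tr (ρ a) = ∫ ψ_ρ dμ` for every state `ρ`. -/
def HasQIntegral (ν : POVM H m) (ψ : X → H →L[ℂ] H) (a : H →L[ℂ] H) : Prop :=
  IsQIntegrable ν ψ ∧ ∀ ρ : H →L[ℂ] H, IsState ρ →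
    tr (ρ * a) = ∫ x, scalarized ν ψ ρ x ∂ν.inducedMeasure

/-- `φ` is a version of the quantum conditional expectation of `ψ` given the sub-σ-algebra `F`
relative to `ν`: it is `F`-measurable, integrable, and `∫_E φ dν' = ∫_E ψ dν` for all `E ∈ F`,
where `ν'` is the restriction of `ν` to `F` and each integral is taken with respect to the
principal Radon–Nikodým derivative of the measure that it carries. -/
def IsQCE (ν : POVM H m) {F : MeasurableSpace X} (hF : F ≤ m) (ψ φ : X → H →L[ℂ] H) : Prop :=
  IsQRV F φ ∧ IsQIntegrable (ν.restrict hF) φ ∧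
    ∀ E, MeasurableSet[F] E → ∃ a : H →L[ℂ] H,
      HasQIntegral ν (E.indicator ψ) a ∧ HasQIntegral (ν.restrict hF) (E.indicator φ) a

/-- The compression `v* a v` of `a` by an isometry `v` of `ℂᵏ` into `H`: the compression of `a` to
the subspace `range v`, written in the orthonormal basis of `range v` that `v` provides. -/
def compress {k : ℕ} (v : EuclideanSpace ℂ (Fin k) →ₗᵢ[ℂ] H) (a : H →L[ℂ] H) :
    EuclideanSpace ℂ (Fin k) →L[ℂ] EuclideanSpace ℂ (Fin k) :=
  ContinuousLinearMap.adjoint v.toContinuousLinearMap ∘L a ∘L v.toContinuousLinearMap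

/-- `ϑ` is operator convex on `J`: the convexity inequality holds for all selfadjoint matrices, of
every size, with spectrum in `J`. -/
def OperatorConvexOn (J : Set ℝ) (ϑ : ℝ → ℝ) : Prop :=
  ∀ (n : ℕ) (a b : EuclideanSpace ℂ (Fin n) →L[ℂ] EuclideanSpace ℂ (Fin n)),
    IsSelfAdjoint a → IsSelfAdjoint b → spectrum ℝ a ⊆ J → spectrum ℝ b ⊆ J →
    ∀ t : ℝ, 0 ≤ t → t ≤ 1 →
      cfc ϑ (t • a + (1 - t) • b) ≤ t • cfc ϑ a + (1 - t) • cfc ϑ b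

end QuantumProb
end

set_option linter.unusedSectionVars false

noncomputable section

namespace QuantumProb

/-! ### Operator Jensen inequality for finite positive operator valued measures -/

section OperatorJensen

variable {H K L : Type*} [NormedAddCommGroup H] [InnerProductSpace ℂ H] [FiniteDimensional ℂ H]
  [CompleteSpace H] [NormedAddCommGroup K] [InnerProductSpace ℂ K] [FiniteDimensional ℂ K]
  [CompleteSpace K] [NormedAddCommGroup L] [InnerProductSpace ℂ L] [FiniteDimensional ℂ L]
  [CompleteSpace L]

open ContinuousLinearMap (adjoint)

/-! Let `μ` be the induced measure of `ν` and `D` the density of the restriction of `ν` to `F`. By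
`isQCE_iff`, an `F`-measurable `φ` is a version of the conditional expectation of `ψ` exactly when
`√D φ √D` is, almost everywhere, the ordinary conditional expectation under `μ` of `√(dν/dμ) ψ
√(dν/dμ)`. The latter is positive and linear in `ψ` and sends `1` to `D`. For bounded selfadjoint
`ψ` it therefore lies between `-C D` and `C D`, so it lives on the support of `D`, and a generalised
inverse of `√D` recovers a version: this is existence.

For the inequality, a Bernstein partition of unity `h k` with nodes `c k` is applied to `ψ`.
Conditioning the sandwiched `h k (ψ)` gives positive operators `G k` with sum `D`. Bernstein
operators reproduce the identity, so `∑ c k • G k` is exactly `√D φ √D`, while `∑ ϑ (c k) • G k`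
exceeds `√D ω √D` by at most `ε D` (`ae_exists_conditional_partition`). Compressing to the range of
`D` normalises the total mass to `1`, and the finite Jensen inequality `OperatorConvexOn.cfc_sum_le`
applies; then `ε` tends to zero (`OperatorConvexOn.jensen_on_range`).

The finite inequality is a Naimark dilation: the column of the `√(Q k)` is an isometry that
compresses a diagonal operator to `∑ c k • Q k`. Jensen for a compression comes from averaging an
operator with its conjugate by the reflection in the range of the isometry. -/

lemma finite_real_spectrum (a : H →L[ℂ] H) : (spectrum ℝ a).Finite := by
  have hint : IsIntegral ℝ a := Algebra.IsIntegral.isIntegral a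
  refine (Polynomial.rootSet_finite (minpoly ℝ a) ℝ).subset fun r hr => ?_
  have h := spectrum.subset_polynomial_aeval a (minpoly ℝ a) ⟨r, hr, rfl⟩
  rw [minpoly.aeval] at h
  rw [Polynomial.mem_rootSet]
  refine ⟨minpoly.ne_zero hint, ?_⟩
  by_contra h0
  refine h ?_
  rw [spectrum.mem_resolventSet_iff, sub_zero]
  exact (IsUnit.mk0 _ (by simpa using h0)).map (algebraMap ℝ (H →L[ℂ] H))

/-- The spectrum is finite, so the functional calculus of a selfadjoint operator never falls back to
its default value. -/
lemma continuousOn_real_spectrum (f : ℝ → ℝ) (a : H →L[ℂ] H) : ContinuousOn f (spectrum ℝ a) :=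
  (finite_real_spectrum a).continuousOn f

/-- One polynomial interpolates `f` on the union of the two finite spectra, and intertwining passes
to powers. -/
lemma cfc_comp_of_comp_eq {a : K →L[ℂ] K} {b : L →L[ℂ] L} (ha : IsSelfAdjoint a)
    (hb : IsSelfAdjoint b) (W : K →L[ℂ] L) (h : b ∘L W = W ∘L a) (f : ℝ → ℝ) :
    cfc f b ∘L W = W ∘L cfc f a := by
  classical
  have hfin := (finite_real_spectrum a).union (finite_real_spectrum b)
  let p : Polynomial ℝ := Lagrange.interpolate hfin.toFinset id f
  have hp : ∀ r ∈ spectrum ℝ a ∪ spectrum ℝ b, f r = p.eval r := fun r hr =>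
    (Lagrange.eval_interpolate_at_node (v := id) f Function.injective_id.injOn
      (hfin.mem_toFinset.2 hr)).symm
  rw [cfc_congr (g := fun r => p.eval r) fun r hr => hp r (Or.inl hr),
    cfc_congr (a := b) (g := fun r => p.eval r) fun r hr => hp r (Or.inr hr),
    cfc_polynomial p a, cfc_polynomial p b]
  have hpow : ∀ n : ℕ, (b ^ n) ∘L W = W ∘L (a ^ n) := by
    intro n
    induction n with
    | zero => rfl
    | succ n ih =>
      calc (b ^ (n + 1)) ∘L W = (b ^ n) ∘L (b ∘L W) := by rw [pow_succ]; rfl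
        _ = ((b ^ n) ∘L W) ∘L a := by rw [h]; rfl
        _ = W ∘L (a ^ (n + 1)) := by rw [ih, pow_succ]; rfl
  induction p using Polynomial.induction_on' with
  | add p q hp hq =>
    simp only [map_add, ContinuousLinearMap.add_comp, ContinuousLinearMap.comp_add, hp, hq]
  | monomial n c =>
    simp only [Polynomial.aeval_monomial, ← Algebra.smul_def, ContinuousLinearMap.smul_comp, hpow]
    ext y
    simp

/-- An orthonormal basis identifies the operators on `L` with matrices by a star isomorphism, which
respects order, spectrum and functional calculus. -/
lemma OperatorConvexOn.le_of_finiteDimensional {J : Set ℝ} {ϑ : ℝ → ℝ}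
    (hϑ : OperatorConvexOn J ϑ) {a b : L →L[ℂ] L} (ha : IsSelfAdjoint a) (hb : IsSelfAdjoint b)
    (haJ : spectrum ℝ a ⊆ J) (hbJ : spectrum ℝ b ⊆ J) {t : ℝ} (ht0 : 0 ≤ t) (ht1 : t ≤ 1) :
    cfc ϑ (t • a + (1 - t) • b) ≤ t • cfc ϑ a + (1 - t) • cfc ϑ b := by
  let e := (stdOrthonormalBasis ℂ L).repr.conjStarAlgEquiv
  have he : Continuous e := (e.toAlgEquiv.toLinearMap).continuous_of_finiteDimensional
  have hsmul : ∀ (r : ℝ) (c : L →L[ℂ] L), e (r • c) = r • e c := fun r c => map_smul (e.toAlgEquiv.toLinearEquiv.restrictScalars ℝ) r c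
  have hcfc : ∀ c : L →L[ℂ] L, IsSelfAdjoint c → e (cfc ϑ c) = cfc ϑ (e c) := fun c hc =>
    StarAlgHomClass.map_cfc (S := ℂ) e ϑ c (continuousOn_real_spectrum _ _) he hc (hc.map e)
  have hspec : ∀ c : L →L[ℂ] L, spectrum ℝ (e c) = spectrum ℝ c := fun c =>
    AlgEquiv.spectrum_eq (e.toAlgEquiv.restrictScalars ℝ) c
  have key := hϑ _ (e a) (e b) (ha.map e) (hb.map e) ((hspec a).trans_subset haJ)
    ((hspec b).trans_subset hbJ) t ht0 ht1
  rw [← hcfc a ha, ← hcfc b hb, ← hsmul, ← hsmul, ← hsmul, ← hsmul, ← map_add, ← map_add,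
    ← hcfc _ (((IsSelfAdjoint.all t).smul ha).add ((IsSelfAdjoint.all (1 - t)).smul hb))] at key
  exact (map_le_map_iff e).1 key

lemma cfc_symmetry_conj {U a : L →L[ℂ] L} (hU : IsSelfAdjoint U) (hUU : U * U = 1)
    (ha : IsSelfAdjoint a) (f : ℝ → ℝ) : cfc f (U * a * U) = U * cfc f a * U := by
  have hca : IsSelfAdjoint (U * a * U) := by simpa [hU.star_eq] using ha.conjugate U
  have hcU : (U * a * U) * U = U * a := by rw [mul_assoc, hUU, mul_one]
  have h : cfc f (U * a * U) * U = U * cfc f a := cfc_comp_of_comp_eq ha hca U hcU f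
  rw [← h, mul_assoc _ U U, hUU, mul_one]

lemma spectrum_symmetry_conj {U : L →L[ℂ] L} (hUU : U * U = 1) (a : L →L[ℂ] L) :
    spectrum ℝ (U * a * U) = spectrum ℝ a :=
  spectrum.units_conjugate (R := ℝ) (a := a) (u := ⟨U, U, hUU, hUU⟩)

/-- Jensen's inequality for the compression by an isometry. -/
lemma OperatorConvexOn.cfc_compression_le {J : Set ℝ} {ϑ : ℝ → ℝ}
    (hϑ : OperatorConvexOn J ϑ) {a : L →L[ℂ] L} (ha : IsSelfAdjoint a) (haJ : spectrum ℝ a ⊆ J)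
    (V : K →L[ℂ] L) (hV : adjoint V ∘L V = 1) :
    cfc ϑ (adjoint V ∘L a ∘L V) ≤ adjoint V ∘L cfc ϑ a ∘L V := by
  have hV' : ∀ y, adjoint V (V y) = y := fun y => congrArg (fun T : K →L[ℂ] K => T y) hV
  -- `U = 2 V V* - 1` is the reflection in the range of `V`.
  obtain ⟨U, hUapp, hUsa⟩ : ∃ U : L →L[ℂ] L, (∀ z, U z = (2 : ℝ) • V (adjoint V z) - z) ∧
      IsSelfAdjoint U := by
    refine ⟨(2 : ℝ) • (V ∘L adjoint V) - 1, fun z => rfl,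
      IsSelfAdjoint.sub (IsSelfAdjoint.smul (.all _) ?_) (.one _)⟩
    rw [ContinuousLinearMap.isSelfAdjoint_iff', ContinuousLinearMap.adjoint_comp,
      ContinuousLinearMap.adjoint_adjoint]
  have hUV : ∀ y, U (V y) = V y := fun y => by rw [hUapp, hV', two_smul]; abel
  have hVU : ∀ z, adjoint V (U z) = adjoint V z := fun z => by
    rw [hUapp, map_sub, two_smul, map_add, hV']; abel
  have hUU : U * U = 1 := by
    ext z
    rw [mul_apply_eq_comp, hUapp (U z), hVU, hUapp, one_apply_eq_self]
    abel
  have hca : IsSelfAdjoint (U * a * U) := by simpa [hUsa.star_eq] using ha.conjugate U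
  have key := hϑ.le_of_finiteDimensional ha hca haJ
    ((spectrum_symmetry_conj hUU a).trans_subset haJ) (t := 1 / 2) (by norm_num) (by norm_num)
  rw [cfc_symmetry_conj hUsa hUU ha] at key
  have hbsa : IsSelfAdjoint ((1 / 2 : ℝ) • a + (1 - 1 / 2 : ℝ) • (U * a * U)) :=
    ((IsSelfAdjoint.all _).smul ha).add ((IsSelfAdjoint.all _).smul hca)
  -- Averaging over the reflection kills the off-diagonal blocks, so `V` intertwines the average
  -- with the compression of `a`, and hence also their functional calculi.
  have hbV : ((1 / 2 : ℝ) • a + (1 - 1 / 2 : ℝ) • (U * a * U)) ∘L V =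
      V ∘L (adjoint V ∘L a ∘L V) := by
    ext y
    simp only [ContinuousLinearMap.comp_apply, add_apply,
      smul_apply, mul_apply_eq_comp, hUV, hUapp (a (V y))]
    module
  have h1 := cfc_comp_of_comp_eq (ha.adjoint_conj V) hbsa V hbV ϑ
  have h3 : adjoint V ∘L ((1 / 2 : ℝ) • cfc ϑ a + (1 - 1 / 2 : ℝ) • (U * cfc ϑ a * U)) ∘L V =
      adjoint V ∘L cfc ϑ a ∘L V := by
    ext y
    simp only [ContinuousLinearMap.comp_apply, add_apply,
      smul_apply, mul_apply_eq_comp, hUV, map_add,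
      ContinuousLinearMap.map_smul_of_tower, hVU]
    module
  calc cfc ϑ (adjoint V ∘L a ∘L V)
      = adjoint V ∘L cfc ϑ ((1 / 2 : ℝ) • a + (1 - 1 / 2 : ℝ) • (U * a * U)) ∘L V := by
        rw [h1]
        ext y
        exact (hV' _).symm
    _ ≤ adjoint V ∘L ((1 / 2 : ℝ) • cfc ϑ a + (1 - 1 / 2 : ℝ) • (U * cfc ϑ a * U)) ∘L V := by
        rw [ContinuousLinearMap.le_def, ← ContinuousLinearMap.comp_sub,
          ← ContinuousLinearMap.sub_comp]
        exact ((ContinuousLinearMap.le_def _ _).1 key).adjoint_conj V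
    _ = adjoint V ∘L cfc ϑ a ∘L V := h3

section Diagonal

variable {ι : Type*} [Fintype ι]

variable (K) in
/-- The operator on the `ι`-fold sum of `K` that multiplies the `i`-th component by `c i`. -/
def diagonalOp (c : ι → ℝ) : PiLp 2 (fun _ : ι => K) →L[ℂ] PiLp 2 (fun _ : ι => K) :=
  LinearMap.toContinuousLinearMap
    { toFun := fun z => WithLp.toLp 2 fun i => c i • z i
      map_add' := fun y z => by ext i; simp
      map_smul' := fun r z => by
        ext i; exact smul_comm (c i) r (z i) }

@[simp]
lemma diagonalOp_apply (c : ι → ℝ) (z : PiLp 2 (fun _ : ι => K)) (i : ι) :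
    diagonalOp K c z i = c i • z i := rfl

lemma isSelfAdjoint_diagonalOp (c : ι → ℝ) : IsSelfAdjoint (diagonalOp K c) := by
  rw [ContinuousLinearMap.isSelfAdjoint_iff_isSymmetric]
  intro y z
  simp [PiLp.inner_apply, inner_smul_left_eq_smul, inner_smul_right_eq_smul]

lemma spectrum_diagonalOp_subset (c : ι → ℝ) : spectrum ℝ (diagonalOp K c) ⊆ range c := by
  intro r hr
  by_contra h
  have hne : ∀ i, r - c i ≠ 0 := fun i hi => h ⟨i, (sub_eq_zero.1 hi).symm⟩
  refine hr ?_
  refine ⟨⟨algebraMap ℝ _ r - diagonalOp K c, diagonalOp K fun i => (r - c i)⁻¹, ?_, ?_⟩, rfl⟩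
  · ext z i
    simp [Algebra.algebraMap_eq_smul_one, smul_smul, ← sub_smul]
    rw [← sub_mul, mul_inv_cancel₀ (hne i), one_smul]
  · ext z i
    simp [Algebra.algebraMap_eq_smul_one, smul_smul, ← sub_smul]
    rw [mul_comm r, ← mul_sub, inv_mul_cancel₀ (hne i), one_smul]

/-- Each coordinate projection intertwines the diagonal operator with a scalar. -/
lemma cfc_diagonalOp (f : ℝ → ℝ) (c : ι → ℝ) :
    cfc f (diagonalOp K c) = diagonalOp K (f ∘ c) := by
  ext z i
  let π : PiLp 2 (fun _ : ι => K) →L[ℂ] K := PiLp.proj 2 _ i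
  have h := cfc_comp_of_comp_eq (isSelfAdjoint_diagonalOp c)
    (b := algebraMap ℝ (K →L[ℂ] K) (c i)) (.algebraMap _ (.all _)) π
    (by ext z; simp [π, Algebra.algebraMap_eq_smul_one]) f
  rw [cfc_algebraMap] at h
  have := congrArg (fun T : PiLp 2 (fun _ : ι => K) →L[ℂ] K => T z) h
  simpa [π, Algebra.algebraMap_eq_smul_one] using this.symm

/-- The column of the square roots of a finite family of operators. -/
def sqrtColumn (Q : ι → K →L[ℂ] K) : K →L[ℂ] PiLp 2 (fun _ : ι => K) :=
  LinearMap.toContinuousLinearMap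
    { toFun := fun y => WithLp.toLp 2 fun i => CFC.sqrt (Q i) y
      map_add' := fun y z => by ext i; simp
      map_smul' := fun r z => by ext i; simp }

/-- The case `c = 1` shows that the column is an isometry when the `Q i` sum to `1`; the general
case exhibits the weighted sums as compressions. -/
lemma adjoint_sqrtColumn_comp (Q : ι → K →L[ℂ] K) (hQ : ∀ i, 0 ≤ Q i) (c : ι → ℝ) :
    adjoint (sqrtColumn Q) ∘L diagonalOp K c ∘L sqrtColumn Q = ∑ i, c i • Q i := by
  ext y
  refine ext_inner_left ℂ fun z => ?_
  have h : ∀ i, inner ℂ (CFC.sqrt (Q i) z) (CFC.sqrt (Q i) y) = inner ℂ z (Q i y) := fun i => by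
    have hs : IsSelfAdjoint (CFC.sqrt (Q i)) := (CFC.sqrt_nonneg (Q i)).isSelfAdjoint
    rw [ContinuousLinearMap.isSelfAdjoint_iff_isSymmetric] at hs
    rw [hs.apply_clm]
    conv_rhs => rw [← CFC.sqrt_mul_sqrt_self (Q i) (hQ i)]
    rfl
  simp only [ContinuousLinearMap.comp_apply, ContinuousLinearMap.adjoint_inner_right,
    PiLp.inner_apply, diagonalOp_apply, sum_apply, inner_sum,
    smul_apply, inner_smul_right_eq_smul, ← h]
  rfl

/-- Jensen's inequality for a finite positive operator valued measure on the line. -/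
lemma OperatorConvexOn.cfc_sum_le {J : Set ℝ} {ϑ : ℝ → ℝ} (hϑ : OperatorConvexOn J ϑ)
    (Q : ι → K →L[ℂ] K) (hQ : ∀ i, 0 ≤ Q i) (hQ1 : ∑ i, Q i = 1) (c : ι → ℝ) (hc : ∀ i, c i ∈ J) :
    cfc ϑ (∑ i, c i • Q i) ≤ ∑ i, ϑ (c i) • Q i := by
  have hV : adjoint (sqrtColumn Q) ∘L sqrtColumn Q = 1 := by
    have h1 : diagonalOp K (fun _ : ι => (1 : ℝ)) = 1 := by ext z i; simp
    have := adjoint_sqrtColumn_comp Q hQ fun _ => 1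
    rw [h1] at this
    simpa only [ContinuousLinearMap.one_def, ContinuousLinearMap.id_comp, one_smul, hQ1] using this
  have := hϑ.cfc_compression_le (isSelfAdjoint_diagonalOp c)
    ((spectrum_diagonalOp_subset c).trans (range_subset_iff.2 hc)) (sqrtColumn Q) hV
  rw [cfc_diagonalOp, adjoint_sqrtColumn_comp Q hQ, adjoint_sqrtColumn_comp Q hQ] at this
  exact this

end Diagonal

/-- Scalar weights on a one-dimensional space. Convexity supplies the continuity of `ϑ` on the open
interval. -/
lemma OperatorConvexOn.convexOn {J : Set ℝ} {ϑ : ℝ → ℝ} (hϑ : OperatorConvexOn J ϑ)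
    (hJ : J.OrdConnected) : ConvexOn ℝ J ϑ := by
  refine ⟨hJ.convex, fun x hx y hy s t hs ht hst => ?_⟩
  let K₁ := EuclideanSpace ℂ (Fin 1)
  have h := hϑ.cfc_sum_le (K := K₁) (ι := Fin 2)
    (fun i => algebraMap ℝ (K₁ →L[ℂ] K₁) (![s, t] i))
    (fun i => algebraMap_nonneg _ (by fin_cases i <;> simpa))
    (by rw [← map_sum, Fin.sum_univ_two]; exact (congrArg _ hst).trans (map_one _)) ![x, y] (fun i => by fin_cases i <;> simpa)
  simp only [← map_sum, Algebra.smul_def, ← map_mul, cfc_algebraMap] at h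
  have := (algebraMap_le_algebraMap (α := ℝ) (β := K₁ →L[ℂ] K₁)).1 h
  simpa [mul_comm] using this

end OperatorJensen

/-! ### Bernstein partitions of unity -/

open ContinuousLinearMap (adjoint)

lemma bernstein_mean {n : ℕ} (hn : n ≠ 0) (x : unitInterval) :
    ∑ k : Fin (n + 1), (bernstein.z k : ℝ) * bernstein n k x = x := by
  have h := bernsteinPolynomial.sum_smul ℝ n
  apply_fun fun p => Polynomial.eval (x : ℝ) p at h
  have hn' : (n : ℝ) ≠ 0 := by exact_mod_cast hn
  simp only [Finset.sum_range, Polynomial.eval_finsetSum, nsmul_eq_mul, Polynomial.eval_mul,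
    Polynomial.eval_natCast, Polynomial.eval_X] at h
  rw [← mul_right_inj' hn', ← h, Finset.mul_sum]
  refine Finset.sum_congr rfl fun k _ => ?_
  change (n : ℝ) * ((k : ℝ) / n * (bernsteinPolynomial ℝ n k).eval (x : ℝ)) = _
  field_simp

/-- A continuous function on a compact interval is approximated from below, up to `ε`, by averages
of its values with respect to a continuous partition of unity with barycentre the identity. -/
lemma exists_partition_of_unity_approx {α β : ℝ} (hαβ : α ≤ β) {f : ℝ → ℝ}
    (hf : ContinuousOn f (Icc α β)) {ε : ℝ} (hε : 0 < ε) :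
    ∃ (N : ℕ) (c : Fin N → ℝ) (h : Fin N → ℝ → ℝ), (∀ k, c k ∈ Icc α β) ∧
      (∀ k, Continuous (h k)) ∧ (∀ k t, 0 ≤ h k t) ∧ (∀ t, ∑ k, h k t = 1) ∧
      (∀ t ∈ Icc α β, ∑ k, c k * h k t = t) ∧
      ∀ t ∈ Icc α β, ∑ k, f (c k) * h k t ≤ f t + ε := by
  have hmem : ∀ s : unitInterval, α + (β - α) * s ∈ Icc α β := fun s =>
    ⟨by nlinarith [s.2.1], by nlinarith [s.2.2]⟩
  let g : C(unitInterval, ℝ) := ⟨fun s => f (α + (β - α) * s),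
    hf.comp_continuous (by fun_prop) hmem⟩
  -- The degree must be nonzero for the nodes `k / n` to have mean `x`.
  obtain ⟨n, hn, hn0⟩ := (((Metric.tendsto_nhds.1 (bernsteinApproximation_uniform g)) ε hε).and
    (Filter.eventually_ne_atTop 0)).exists
  -- Clamping makes the `h k` continuous, nonnegative and of sum `1` on the whole line. For `α = β`
  -- the quotient is `0` by convention, which is harmless.
  let σ : ℝ → unitInterval := fun t => projIcc 0 1 zero_le_one ((t - α) / (β - α))
  have hσ : ∀ t ∈ Icc α β, α + (β - α) * (σ t : ℝ) = t := fun t ht => by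
    have h0 : (t - α) / (β - α) ∈ Icc (0 : ℝ) 1 :=
      ⟨div_nonneg (by linarith [ht.1]) (by linarith),
        div_le_one_of_le₀ (by linarith [ht.2]) (by linarith)⟩
    simp only [σ, projIcc_of_mem _ h0]
    rcases hαβ.eq_or_lt with rfl | hlt
    · simpa using ht.1.antisymm ht.2
    · have : β - α ≠ 0 := by linarith
      field_simp
      ring
  refine ⟨n + 1, fun k => α + (β - α) * (bernstein.z k : ℝ), fun k t => bernstein n k (σ t),
    fun k => hmem _, fun k => ?_, fun k t => bernstein_nonneg,
    fun t => bernstein.probability n (σ t), fun t ht => ?_, fun t ht => ?_⟩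
  · exact (bernstein n k).continuous.comp (continuous_projIcc.comp (by fun_prop))
  · simp only [add_mul, Finset.sum_add_distrib, mul_assoc, ← Finset.mul_sum,
      bernstein.probability, bernstein_mean hn0, mul_one]
    exact hσ t ht
  · have h1 : dist (bernsteinApproximation n g (σ t)) (g (σ t)) < ε :=
      (ContinuousMap.dist_apply_le_dist _).trans_lt hn
    have h2 : g (σ t) = f t := congrArg f (hσ t ht)
    rw [h2, bernsteinApproximation.apply, Real.dist_eq] at h1
    have h3 := (abs_lt.1 h1).2
    simp only [smul_eq_mul, mul_comm (bernstein n _ _)] at h3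
    exact (sub_lt_iff_lt_add'.1 h3).le

/-! ### Operator inequalities on the range of the density -/

section Pointwise

variable {H K : Type*} [NormedAddCommGroup H] [InnerProductSpace ℂ H] [FiniteDimensional ℂ H]
  [CompleteSpace H] [NormedAddCommGroup K] [InnerProductSpace ℂ K] [FiniteDimensional ℂ K]
  [CompleteSpace K]

lemma adjoint_conj_mono {a b : H →L[ℂ] H} (h : a ≤ b) (R : K →L[ℂ] H) :
    adjoint R ∘L a ∘L R ≤ adjoint R ∘L b ∘L R := by
  rw [ContinuousLinearMap.le_def, ← ContinuousLinearMap.comp_sub, ← ContinuousLinearMap.sub_comp]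
  exact ((ContinuousLinearMap.le_def _ _).1 h).adjoint_conj R

lemma adjoint_conj_sum {ι : Type*} [Fintype ι] (c : ι → ℝ) (G : ι → H →L[ℂ] H) (R : K →L[ℂ] H) :
    adjoint R ∘L (∑ k, c k • G k) ∘L R = ∑ k, c k • (adjoint R ∘L G k ∘L R) := by
  ext y
  simp [sum_apply, map_sum]

/-- The range of `D = √D √D` lies in that of `√D`, so `v` lifts through `√D`. The lift plays the
role of `D^{-1/2} v` without inverting `D`. -/
lemma exists_sqrt_comp_eq {D : H →L[ℂ] H} (hD : 0 ≤ D) (v : K →L[ℂ] H)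
    (hv : LinearMap.range v.toLinearMap ≤ LinearMap.range D.toLinearMap) :
    ∃ R : K →L[ℂ] H, CFC.sqrt D ∘L R = v := by
  have hmem : ∀ y, v y ∈ LinearMap.range (CFC.sqrt D).toLinearMap := fun y => by
    obtain ⟨z, hz⟩ := hv ⟨y, rfl⟩
    refine ⟨CFC.sqrt D z, Eq.trans ?_ hz⟩
    exact congrArg (fun T : H →L[ℂ] H => T z) (CFC.sqrt_mul_sqrt_self D hD)
  obtain ⟨R, hR⟩ := Module.projective_lifting_property (CFC.sqrt D).toLinearMap.rangeRestrict
    (v.toLinearMap.codRestrict _ hmem) (LinearMap.surjective_rangeRestrict _)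
  refine ⟨LinearMap.toContinuousLinearMap R, ?_⟩
  ext y
  exact congrArg Subtype.val (LinearMap.congr_fun hR y)

/-- Jensen's inequality for a family of finite positive operator valued measures of total mass `D`
that approximates `ω` from below and has barycentre `φ`, compressed to the range of `D`. -/
lemma OperatorConvexOn.jensen_on_range {J : Set ℝ} {ϑ : ℝ → ℝ} (hϑ : OperatorConvexOn J ϑ)
    {α β : ℝ} (hJ : Icc α β ⊆ J) {D φ ω : H →L[ℂ] H} (hD : 0 ≤ D)
    (h : ∀ n : ℕ, ∃ (N : ℕ) (c : Fin N → ℝ) (G : Fin N → H →L[ℂ] H), (∀ k, c k ∈ Icc α β) ∧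
      (∀ k, 0 ≤ G k) ∧ ∑ k, G k = D ∧ ∑ k, c k • G k = CFC.sqrt D * φ * CFC.sqrt D ∧
      ∑ k, ϑ (c k) • G k ≤ CFC.sqrt D * ω * CFC.sqrt D + (1 / (n + 1 : ℝ)) • D)
    (v : K →L[ℂ] H) (hv1 : adjoint v ∘L v = 1)
    (hv : LinearMap.range v.toLinearMap ≤ LinearMap.range D.toLinearMap) :
    IsSelfAdjoint (adjoint v ∘L φ ∘L v) ∧ spectrum ℝ (adjoint v ∘L φ ∘L v) ⊆ Icc α β ∧
      cfc ϑ (adjoint v ∘L φ ∘L v) ≤ adjoint v ∘L ω ∘L v := by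
  obtain ⟨R, hR⟩ := exists_sqrt_comp_eq hD v hv
  have hS : adjoint (CFC.sqrt D) = CFC.sqrt D := (CFC.sqrt_nonneg D).isSelfAdjoint.star_eq
  have hR' : adjoint R ∘L CFC.sqrt D = adjoint v := by
    rw [← hR, ContinuousLinearMap.adjoint_comp, hS]
  -- Conjugation by `R` undoes the factors `√D`: sandwiches become compressions, and `D` becomes
  -- `1`.
  have hconj : ∀ a : H →L[ℂ] H,
      adjoint R ∘L (CFC.sqrt D * a * CFC.sqrt D) ∘L R = adjoint v ∘L a ∘L v := fun a => by
    rw [← hR', ← hR]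
    rfl
  have hconjD : adjoint R ∘L D ∘L R = 1 := by
    rw [← hv1, ← hR', ← hR]
    conv_lhs => rw [← CFC.sqrt_mul_sqrt_self D hD]
    rfl
  have key : ∀ n : ℕ, ∃ (N : ℕ) (c : Fin N → ℝ) (Q : Fin N → K →L[ℂ] K),
      (∀ k, c k ∈ Icc α β) ∧ (∀ k, 0 ≤ Q k) ∧ ∑ k, Q k = 1 ∧
      ∑ k, c k • Q k = adjoint v ∘L φ ∘L v ∧
      ∑ k, ϑ (c k) • Q k ≤ adjoint v ∘L ω ∘L v + (1 / (n + 1 : ℝ)) • 1 := by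
    intro n
    obtain ⟨N, c, G, hc, hG, hG1, hGφ, hGω⟩ := h n
    refine ⟨N, c, fun k => adjoint R ∘L G k ∘L R, hc, fun k => ?_, ?_, ?_, ?_⟩
    · simpa using adjoint_conj_mono (hG k) R
    · have := adjoint_conj_sum (fun _ => 1) G R
      simp only [one_smul, hG1, hconjD] at this
      exact this.symm
    · rw [← adjoint_conj_sum, hGφ, hconj]
    · rw [← adjoint_conj_sum]
      refine (adjoint_conj_mono hGω R).trans_eq ?_
      rw [ContinuousLinearMap.add_comp, ContinuousLinearMap.comp_add, hconj, ← hconjD]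
      congr 1
      ext y
      simp
  have hsa : IsSelfAdjoint (adjoint v ∘L φ ∘L v) := by
    obtain ⟨N, c, Q, -, hQ, -, h1, -⟩ := key 0
    rw [← h1]
    exact isSelfAdjoint_sum _ fun k _ => (IsSelfAdjoint.all (c k)).smul (hQ k).isSelfAdjoint
  refine ⟨hsa, ?_, ?_⟩
  -- The barycentre is exact, so any single member of the family gives the spectral bounds.
  · obtain ⟨N, c, Q, hc, hQ, hQ1, h1, -⟩ := key 0
    have hlow : algebraMap ℝ (K →L[ℂ] K) α ≤ adjoint v ∘L φ ∘L v := by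
      rw [Algebra.algebraMap_eq_smul_one, ← h1, ← hQ1, Finset.smul_sum]
      exact Finset.sum_le_sum fun k _ => smul_le_smul_of_nonneg_right (hc k).1 (hQ k)
    have hupp : adjoint v ∘L φ ∘L v ≤ algebraMap ℝ (K →L[ℂ] K) β := by
      rw [Algebra.algebraMap_eq_smul_one, ← h1, ← hQ1, Finset.smul_sum]
      exact Finset.sum_le_sum fun k _ => smul_le_smul_of_nonneg_right (hc k).2 (hQ k)
    exact fun r hr => ⟨(algebraMap_le_iff_le_spectrum (R := ℝ) hsa).1 hlow r hr,
      (le_algebraMap_iff_spectrum_le (R := ℝ) hsa).1 hupp r hr⟩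
  · have hle : ∀ n : ℕ, cfc ϑ (adjoint v ∘L φ ∘L v) ≤
        adjoint v ∘L ω ∘L v + (1 / (n + 1 : ℝ)) • 1 := fun n => by
      obtain ⟨N, c, Q, hc, hQ, hQ1, h1, h2⟩ := key n
      rw [← h1]
      exact (hϑ.cfc_sum_le Q hQ hQ1 c fun k => hJ (hc k)).trans h2
    refine ge_of_tendsto' (x := Filter.atTop) ?_ hle
    simpa using (tendsto_const_nhds (x := adjoint v ∘L ω ∘L v)).add
      ((tendsto_one_div_add_atTop_nhds_zero_nat (𝕜 := ℝ)).smul_const (1 : K →L[ℂ] K))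

/-- An operator dominated by `D` factors through the support of `D`. -/
lemma sqrt_mul_invSqrt_conj {D G : H →L[ℂ] H} (hD : 0 ≤ D) (hG : IsSelfAdjoint G) {C : ℝ}
    (hlow : 0 ≤ G + C • D) (hupp : G ≤ C • D) :
    CFC.sqrt D * (cfc (fun t => (√t)⁻¹) D * G * cfc (fun t => (√t)⁻¹) D) * CFC.sqrt D = G := by
  have hDsa := hD.isSelfAdjoint
  have hc : ∀ f : ℝ → ℝ, ContinuousOn f (spectrum ℝ D) := fun f => continuousOn_real_spectrum f D
  have hS : CFC.sqrt D = cfc Real.sqrt D := by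
    rw [CFC.sqrt_eq_real_sqrt D hD, cfcₙ_eq_cfc]
  have hp1 : CFC.sqrt D * cfc (fun t => (√t)⁻¹) D = cfc (fun t => √t * (√t)⁻¹) D := by
    rw [hS, cfc_mul _ _ D (hc _) (hc _)]
  have hp2 : cfc (fun t => (√t)⁻¹) D * CFC.sqrt D = cfc (fun t => √t * (√t)⁻¹) D := by
    rw [hS, ← cfc_mul _ _ D (hc _) (hc _)]
    simp only [mul_comm]
  -- As `(√0)⁻¹ = 0`, this is the support projection of `D`.
  set p : H →L[ℂ] H := cfc (fun t => √t * (√t)⁻¹) D with hp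
  have hpsa : IsSelfAdjoint p := cfc_predicate _ _
  have hDp : D * p = D := by
    have hid : cfc (fun t : ℝ => t) D = D := cfc_id' ℝ D
    conv_lhs => enter [1]; rw [← hid]
    conv_rhs => rw [← hid]
    rw [hp, ← cfc_mul _ _ D (hc _) (hc _)]
    refine cfc_congr fun t ht => ?_
    have ht0 : 0 ≤ t := spectrum_nonneg_of_nonneg hD ht
    rcases ht0.eq_or_lt with rfl | hpos
    · simp
    · have : √t ≠ 0 := (Real.sqrt_pos.2 hpos).ne'
      simp [this]
  -- On the kernel of `D` both bounds become zero, so `G + C • D` has vanishing compression there.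
  -- Being positive, it annihilates that kernel, as its square root does, and hence so does `G`.
  have hGp : G * p = G := by
    have hq : IsSelfAdjoint (1 - p) := (IsSelfAdjoint.one _).sub hpsa
    have hDq : D * (1 - p) = 0 := by rw [mul_sub, mul_one, hDp, sub_self]
    have hAq : (G + C • D) * (1 - p) = G * (1 - p) := by
      rw [add_mul, smul_mul_assoc, hDq, smul_zero, add_zero]
    have h0 : (1 - p) * (G + C • D) * (1 - p) = 0 := by
      refine le_antisymm ?_ (hq.conjugate_nonneg hlow)
      have := hq.conjugate_le_conjugate hupp
      rwa [mul_assoc _ (C • D), smul_mul_assoc, hDq, smul_zero, mul_zero, mul_assoc, ← hAq,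
        ← mul_assoc] at this
    have h1 : CFC.sqrt (G + C • D) * (1 - p) = 0 := by
      rw [← CStarRing.star_mul_self_eq_zero_iff, star_mul, hq.star_eq,
        (CFC.sqrt_nonneg (G + C • D)).isSelfAdjoint.star_eq, mul_assoc,
        ← mul_assoc (CFC.sqrt _) (CFC.sqrt _), CFC.sqrt_mul_sqrt_self _ hlow, ← mul_assoc, h0]
    have h2 : G * (1 - p) = 0 := by
      rw [← hAq, ← CFC.sqrt_mul_sqrt_self _ hlow, mul_assoc, h1, mul_zero]
    rwa [mul_sub, mul_one, sub_eq_zero, eq_comm] at h2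
  have hpG : p * G = G := by
    have := congrArg star hGp
    rwa [star_mul, hpsa.star_eq, hG.star_eq] at this
  calc _ = (CFC.sqrt D * cfc (fun t => (√t)⁻¹) D) * G * (cfc (fun t => (√t)⁻¹) D * CFC.sqrt D) := by
        simp only [mul_assoc]
    _ = G := by rw [hp1, hp2, hpG, hGp]

end Pointwise

/-! ### Testing against states, and measurability of the functional calculus -/

section Trace

variable {X : Type*} {H : Type*} [NormedAddCommGroup H] [InnerProductSpace ℂ H]
  [FiniteDimensional ℂ H] [CompleteSpace H]

/-- The functional `a ↦ tr (b a)`. -/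
def trMul (b : H →L[ℂ] H) : (H →L[ℂ] H) →L[ℂ] ℂ :=
  LinearMap.toContinuousLinearMap
    { toFun := fun a => tr (b * a)
      map_add' := fun a c => by simp [tr, mul_add]
      map_smul' := fun r a => by simp [tr] }

lemma trMul_apply (b a : H →L[ℂ] H) : trMul b a = tr (b * a) := rfl

lemma trMul_add_left (b c a : H →L[ℂ] H) : trMul (b + c) a = trMul b a + trMul c a := by
  simp [trMul_apply, tr, add_mul]

lemma trMul_smul_left (r : ℂ) (b a : H →L[ℂ] H) : trMul (r • b) a = r * trMul b a := by
  simp [trMul_apply, tr]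

lemma trMul_zero_left (a : H →L[ℂ] H) : trMul 0 a = 0 := by
  simp [trMul_apply, tr]

open scoped ComplexOrder in
-- Positive operators span, and a nonzero one is a multiple of a state. Linear conditions imposed on
-- states thus extend to all operators, in particular to the rank-one operators that read off matrix
-- entries.
lemma span_isState : Submodule.span ℂ {ρ : H →L[ℂ] H | IsState ρ} = ⊤ := by
  rw [eq_top_iff, ← CStarAlgebra.span_nonneg (A := H →L[ℂ] H), Submodule.span_le]
  intro p hp
  by_cases h0 : tr p = 0
  · have : p = 0 := POVM.eq_zero_of_tr p hp (by simp [h0])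
    rw [this]
    exact Submodule.zero_mem _
  · have hpos : 0 ≤ tr p :=
      ((ContinuousLinearMap.nonneg_iff_isPositive _).1 hp).toLinearMap.trace_nonneg
    have hinv : 0 ≤ (tr p)⁻¹ := by
      have h1 := Complex.le_def.1 hpos
      have h2 : tr p = ((tr p).re : ℂ) := Complex.ext rfl h1.2.symm
      rw [h2, ← Complex.ofReal_inv]
      exact_mod_cast inv_nonneg.2 h1.1
    have hst : IsState ((tr p)⁻¹ • p) := by
      refine ⟨smul_nonneg hinv hp, ?_⟩
      have : tr ((tr p)⁻¹ • p) = (tr p)⁻¹ * tr p := by simp [tr]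
      rw [this, inv_mul_cancel₀ h0]
    have : p = tr p • ((tr p)⁻¹ • p) := by rw [smul_smul, mul_inv_cancel₀ h0, one_smul]
    rw [this]
    exact Submodule.smul_mem _ _ (Submodule.subset_span hst)

lemma state_induction {P : (H →L[ℂ] H) → Prop} (hst : ∀ ρ, IsState ρ → P ρ) (h0 : P 0)
    (hadd : ∀ a b, P a → P b → P (a + b)) (hsmul : ∀ (r : ℂ) a, P a → P (r • a))
    (b : H →L[ℂ] H) : P b := by
  have hb : b ∈ Submodule.span ℂ {ρ : H →L[ℂ] H | IsState ρ} := by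
    rw [span_isState]; trivial
  induction hb using Submodule.span_induction with
  | mem x h => exact hst x h
  | zero => exact h0
  | add x y _ _ hx hy => exact hadd x y hx hy
  | smul r x _ hx => exact hsmul r x hx

lemma trMul_rankOne (i j : Fin (Module.finrank ℂ H)) (a : H →L[ℂ] H) :
    trMul (InnerProductSpace.rankOne ℂ (stdOrthonormalBasis ℂ H j) (stdOrthonormalBasis ℂ H i)) a =
      inner ℂ (stdOrthonormalBasis ℂ H i) (a (stdOrthonormalBasis ℂ H j)) := by
  rw [trMul_apply, tr, LinearMap.trace_eq_sum_inner _ (stdOrthonormalBasis ℂ H)]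
  simp [orthonormal_iff_ite.1 (stdOrthonormalBasis ℂ H).orthonormal, inner_smul_right]

lemma sum_trMul_rankOne (a : H →L[ℂ] H) :
    a = ∑ i, ∑ j, trMul (InnerProductSpace.rankOne ℂ (stdOrthonormalBasis ℂ H j)
      (stdOrthonormalBasis ℂ H i)) a •
      InnerProductSpace.rankOne ℂ (stdOrthonormalBasis ℂ H i) (stdOrthonormalBasis ℂ H j) := by
  apply ContinuousLinearMap.coe_injective
  apply (stdOrthonormalBasis ℂ H).toBasis.ext
  intro k
  simp [trMul_rankOne, orthonormal_iff_ite.1 (stdOrthonormalBasis ℂ H).orthonormal,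
    OrthonormalBasis.sum_repr']

lemma eq_of_forall_trMul {a b : H →L[ℂ] H} (h : ∀ ρ, IsState ρ → trMul ρ a = trMul ρ b) :
    a = b := by
  have h' : ∀ c, trMul c a = trMul c b := fun c => by
    refine state_induction (P := fun c => trMul c a = trMul c b) h ?_ ?_ ?_ c
    · simp [trMul_zero_left]
    · intro c d hc hd; simp [trMul_add_left, hc, hd]
    · intro r c hc; simp [trMul_smul_left, hc]
  rw [sum_trMul_rankOne a, sum_trMul_rankOne b]
  simp only [h']

lemma isQRV_iff_measurable {m : MeasurableSpace X} {ψ : X → H →L[ℂ] H} :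
    IsQRV m ψ ↔ Measurable[m] ψ := by
  refine ⟨fun h => ?_, fun h ρ _ => (trMul ρ).continuous.measurable.comp h⟩
  have h' : ∀ b, Measurable[m] fun x => trMul b (ψ x) := fun b => by
    refine state_induction (P := fun b => Measurable[m] fun x => trMul b (ψ x)) h ?_ ?_ ?_ b
    · simp [trMul_zero_left]
    · intro c d hc hd; simp only [trMul_add_left]; exact hc.add hd
    · intro r c hc; simpa only [trMul_smul_left] using hc.const_mul r
  have : ψ = fun x => _ := funext fun x => sum_trMul_rankOne (ψ x)
  rw [this]
  exact Finset.measurable_sum _ fun i _ => Finset.measurable_sum _ fun j _ =>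
    (h' _).smul_const _

lemma integrable_iff_trMul {m : MeasurableSpace X} {μ : Measure X} {f : X → H →L[ℂ] H} :
    Integrable f μ ↔ ∀ ρ, IsState ρ → Integrable (fun x => trMul ρ (f x)) μ := by
  refine ⟨fun h ρ _ => (trMul ρ).integrable_comp h, fun h => ?_⟩
  have h' : ∀ b, Integrable (fun x => trMul b (f x)) μ := fun b => by
    refine state_induction (P := fun b => Integrable (fun x => trMul b (f x)) μ) h ?_ ?_ ?_ b
    · simp [trMul_zero_left]
    · intro c d hc hd; simp only [trMul_add_left]; exact hc.add hd
    · intro r c hc; simpa only [trMul_smul_left] using hc.const_mul r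
  have : f = fun x => _ := funext fun x => sum_trMul_rankOne (f x)
  rw [this]
  exact integrable_finsetSum _ fun i _ => integrable_finsetSum _ fun j _ => (h' _).smul_const _

/-- The functional calculus is continuous on the closed set of selfadjoint operators and has the
default value `0` elsewhere. -/
lemma measurable_cfc {f : ℝ → ℝ} (hf : Continuous f) :
    Measurable (cfc f : (H →L[ℂ] H) → (H →L[ℂ] H)) := by
  classical
  have h1 : ContinuousOn (cfc f) {a : H →L[ℂ] H | IsSelfAdjoint a} :=
    ContinuousOn.cfc_of_mem_nhdsSet (s := univ) f Filter.univ_mem continuousOn_id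
      (fun a ha => ha) hf.continuousOn
  have h2 : MeasurableSet {a : H →L[ℂ] H | IsSelfAdjoint a} :=
    (isClosed_eq continuous_star continuous_id).measurableSet
  convert! h1.measurable_piecewise (continuousOn_const (c := (0 : H →L[ℂ] H))) h2 using 1
  ext1 a
  by_cases ha : IsSelfAdjoint a
  · simp [piecewise, ha]
  · simp [piecewise, ha, cfc_apply_of_not_predicate a ha]

lemma measurable_sqrt : Measurable (CFC.sqrt : (H →L[ℂ] H) → (H →L[ℂ] H)) := by
  have h2 : MeasurableSet {a : H →L[ℂ] H | 0 ≤ a} := CStarAlgebra.isClosed_nonneg.measurableSet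
  have h3 := (measurable_cfc (H := H) Real.continuous_sqrt).indicator h2
  convert! h3 using 1
  ext1 a
  by_cases ha : 0 ≤ a
  · rw [CFC.sqrt_eq_real_sqrt a ha, cfcₙ_eq_cfc, indicator_of_mem (s := {a | 0 ≤ a}) ha]
  · rw [CFC.sqrt_of_not_nonneg ha, indicator_of_notMem (s := {a | 0 ≤ a}) ha]

/-- The function is discontinuous at `0` but is a pointwise limit of continuous ones; on a finite
spectrum the convergence is uniform. -/
lemma measurable_cfc_inv_sqrt :
    Measurable (cfc (fun t : ℝ => (√t)⁻¹) : (H →L[ℂ] H) → (H →L[ℂ] H)) := by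
  have hpt : ∀ t : ℝ, Filter.Tendsto (fun n : ℕ => √t / (√t * √t + 1 / (n + 1 : ℝ)))
      Filter.atTop (nhds (√t)⁻¹) := by
    intro t
    by_cases ht : √t = 0
    · simp [ht]
    · have h1 : Filter.Tendsto (fun n : ℕ => √t * √t + 1 / (n + 1 : ℝ)) Filter.atTop
          (nhds (√t * √t + 0)) := tendsto_const_nhds.add tendsto_one_div_add_atTop_nhds_zero_nat
      have h2 := (tendsto_const_nhds (x := √t)).div h1 (by simpa using ht)
      have h3 : √t / (√t * √t + 0) = (√t)⁻¹ := by field_simp; simp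
      rwa [h3] at h2
  refine measurable_of_tendsto_metrizable
    (f := fun (n : ℕ) (a : H →L[ℂ] H) => cfc (fun t : ℝ => √t / (√t * √t + 1 / (n + 1 : ℝ))) a)
    (fun n => measurable_cfc ?_) (tendsto_pi_nhds.2 fun a => ?_)
  · refine Real.continuous_sqrt.div (by fun_prop) fun t => ?_
    have : (0 : ℝ) < 1 / (n + 1 : ℝ) := by positivity
    nlinarith [mul_self_nonneg (√t)]
  · refine tendsto_cfc_fun ?_ (.of_forall fun n => continuousOn_real_spectrum _ _)
    rw [Metric.tendstoUniformlyOn_iff]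
    intro ε hε
    rw [Filter.eventually_all_finite (finite_real_spectrum a)]
    intro t _
    simpa only [dist_comm] using Metric.tendsto_nhds.1 (hpt t) ε hε

end Trace

/-! ### Densities of positive operator valued measures -/

section OperatorValuedMeasure

variable {X : Type*} {H : Type*} [NormedAddCommGroup H] [InnerProductSpace ℂ H]
  [FiniteDimensional ℂ H] [CompleteSpace H]

/-- Positivity is tested on the quadratic forms of a countable dense set of vectors, so that the
null sets can be united; continuity gives the other vectors. -/
lemma ae_nonneg_of_forall_setIntegral_nonneg {m : MeasurableSpace X} {μ : Measure X}
    {f : X → H →L[ℂ] H} (hf : Integrable f μ)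
    (h : ∀ E, MeasurableSet E → 0 ≤ ∫ x in E, f x ∂μ) : ∀ᵐ x ∂μ, 0 ≤ f x := by
  have hlin : ∀ z : H, ∃ T : (H →L[ℂ] H) →L[ℂ] ℂ, ∀ a, T a = inner ℂ z (a z) := fun z =>
    ⟨(innerSL ℂ z) ∘L (ContinuousLinearMap.apply ℂ H z), fun a => rfl⟩
  have hz : ∀ z : H, ∀ᵐ x ∂μ, 0 ≤ (inner ℂ z (f x z)).re ∧ (inner ℂ z (f x z)).im = 0 := by
    intro z
    obtain ⟨T, hT⟩ := hlin z
    have hTf : Integrable (fun x => T (f x)) μ := T.integrable_comp hf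
    have hint : ∀ E, MeasurableSet E → 0 ≤ (∫ x in E, T (f x) ∂μ).re ∧
        (∫ x in E, T (f x) ∂μ).im = 0 := fun E hE => by
      rw [T.integral_comp_comm hf.integrableOn, hT]
      have hpos := (ContinuousLinearMap.nonneg_iff_isPositive _).1 (h E hE)
      have h1 := Complex.le_def.1 (hpos.inner_nonneg_right z)
      exact ⟨h1.1, h1.2.symm⟩
    have hre : 0 ≤ᵐ[μ] fun x => (T (f x)).re := by
      refine MeasureTheory.ae_nonneg_of_forall_setIntegral_nonneg hTf.re fun E hE _ => ?_
      exact (hint E hE).1.trans_eq (integral_re (𝕜 := ℂ) hTf.integrableOn).symm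
    have him : (fun x => (T (f x)).im) =ᵐ[μ] 0 := by
      refine Integrable.ae_eq_zero_of_forall_setIntegral_eq_zero hTf.im fun E hE _ => ?_
      exact (integral_im (𝕜 := ℂ) hTf.integrableOn).trans (hint E hE).2
    filter_upwards [hre, him] with x h1 h2
    rw [← hT]
    exact ⟨h1, h2⟩
  have hall : ∀ᵐ x ∂μ, ∀ n, 0 ≤ (inner ℂ (TopologicalSpace.denseSeq H n)
      (f x (TopologicalSpace.denseSeq H n))).re ∧
      (inner ℂ (TopologicalSpace.denseSeq H n) (f x (TopologicalSpace.denseSeq H n))).im = 0 :=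
    ae_all_iff.2 fun n => hz _
  filter_upwards [hall] with x hx
  have hcl : ∀ z, 0 ≤ (inner ℂ z (f x z)).re ∧ (inner ℂ z (f x z)).im = 0 := by
    intro z
    have hcont : Continuous fun z => inner ℂ z (f x z) := by fun_prop
    have hclosed : IsClosed {z : H | 0 ≤ (inner ℂ z (f x z)).re ∧ (inner ℂ z (f x z)).im = 0} :=
      (isClosed_le continuous_const (Complex.continuous_re.comp hcont)).inter
        (isClosed_eq (Complex.continuous_im.comp hcont) continuous_const)
    refine hclosed.closure_subset_iff.2 ?_ ((TopologicalSpace.denseRange_denseSeq H) z)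
    rintro _ ⟨n, rfl⟩
    exact hx n
  rw [ContinuousLinearMap.nonneg_iff_isPositive, ContinuousLinearMap.isPositive_iff_complex]
  intro z
  obtain ⟨h1, h2⟩ := hcl z
  have h3 : inner ℂ (f x z) z = inner ℂ z (f x z) := by
    rw [← inner_conj_symm, Complex.conj_eq_iff_im]
    exact h2
  rw [h3]
  exact ⟨Complex.ext rfl h2.symm, h1⟩

namespace POVM

variable {m : MeasurableSpace X}

lemma measurable_density (ν : POVM H m) : Measurable ν.density := by
  refine Finset.measurable_sum _ fun i _ => Finset.measurable_sum _ fun j _ =>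
    Measurable.smul_const ?_ _
  exact measurable_of_re_im (SignedMeasure.measurable_rnDeriv _ _)
    (SignedMeasure.measurable_rnDeriv _ _)

lemma integrable_density (ν : POVM H m) : Integrable ν.density ν.inducedMeasure :=
  integrable_finsetSum _ fun i _ => integrable_finsetSum _ fun j _ =>
    (ComplexMeasure.integrable_rnDeriv (ν.entry i j) ν.inducedMeasure).smul_const _

lemma density_nonneg_ae (ν : POVM H m) : ∀ᵐ x ∂ν.inducedMeasure, 0 ≤ ν.density x :=
  ae_nonneg_of_forall_setIntegral_nonneg ν.integrable_density fun E hE => by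
    rw [← ν.density_spec E hE]
    exact ν.nonneg E hE

lemma inducedMeasure_restrict (ν : POVM H m) {F : MeasurableSpace X} (hF : F ≤ m) :
    (ν.restrict hF).inducedMeasure = ν.inducedMeasure.trim hF := by
  refine @Measure.ext X F _ _ fun E hE => ?_
  rw [trim_measurableSet_eq hF hE, inducedMeasure_apply _ hE, inducedMeasure_apply _ (hF E hE)]
  congr 3
  exact congrArg tr (VectorMeasure.trim_measurableSet_eq hF hE)

lemma density_restrict_ae_eq_condExp (ν : POVM H m) {F : MeasurableSpace X} (hF : F ≤ m) :
    (ν.restrict hF).density =ᵐ[ν.inducedMeasure] ν.inducedMeasure[ν.density | F] := by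
  have hsm : StronglyMeasurable[F] (ν.restrict hF).density :=
    (measurable_density (ν.restrict hF)).stronglyMeasurable
  have hint : Integrable (ν.restrict hF).density ν.inducedMeasure := by
    have := (ν.restrict hF).integrable_density
    rw [inducedMeasure_restrict] at this
    exact integrable_of_integrable_trim hF this
  refine ae_eq_condExp_of_forall_setIntegral_eq hF ν.integrable_density
    (fun s _ _ => hint.integrableOn) (fun E hE _ => ?_) hsm.aestronglyMeasurable
  rw [setIntegral_trim hF hsm hE, ← inducedMeasure_restrict, ← density_spec _ E hE,
    ← density_spec _ E (hF E hE)]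
  exact VectorMeasure.trim_measurableSet_eq hF hE

end POVM

/-! ### Reduction to ordinary conditional expectations -/

section Sandwich

variable {m : MeasurableSpace X}

/-- The function `(dν/dμ)^{1/2} ψ (dν/dμ)^{1/2}`, the integrand of `∫ ψ dν` relative to `μ`. -/
def sandwich (ν : POVM H m) (ψ : X → H →L[ℂ] H) (x : X) : H →L[ℂ] H :=
  CFC.sqrt (ν.density x) * ψ x * CFC.sqrt (ν.density x)

lemma scalarized_eq (ν : POVM H m) (ψ : X → H →L[ℂ] H) (ρ : H →L[ℂ] H) (x : X) :
    scalarized ν ψ ρ x = trMul ρ (sandwich ν ψ x) := by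
  simp only [scalarized, sandwich, trMul_apply, mul_assoc]

lemma isQIntegrable_iff (ν : POVM H m) (ψ : X → H →L[ℂ] H) :
    IsQIntegrable ν ψ ↔ Measurable ψ ∧ Integrable (sandwich ν ψ) ν.inducedMeasure := by
  rw [IsQIntegrable, isQRV_iff_measurable, integrable_iff_trMul]
  simp only [← scalarized_eq]

lemma hasQIntegral_iff (ν : POVM H m) (ψ : X → H →L[ℂ] H) (a : H →L[ℂ] H) :
    HasQIntegral ν ψ a ↔
      IsQIntegrable ν ψ ∧ a = ∫ x, sandwich ν ψ x ∂ν.inducedMeasure := by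
  refine and_congr_right fun h => ?_
  have hint := ((isQIntegrable_iff ν ψ).1 h).2
  simp only [scalarized_eq, ← trMul_apply, fun ρ => (trMul ρ).integral_comp_comm hint]
  exact ⟨eq_of_forall_trMul, fun h ρ _ => by rw [h]⟩

lemma measurable_sandwich (ν : POVM H m) {ψ : X → H →L[ℂ] H} (hψ : Measurable ψ) :
    Measurable (sandwich ν ψ) :=
  ((measurable_sqrt.comp ν.measurable_density).mul hψ).mul
    (measurable_sqrt.comp ν.measurable_density)

lemma sandwich_indicator (ν : POVM H m) (ψ : X → H →L[ℂ] H) (E : Set X) :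
    sandwich ν (E.indicator ψ) = E.indicator (sandwich ν ψ) := by
  ext1 x
  by_cases hx : x ∈ E <;> simp [sandwich, hx]

lemma integrable_sandwich (ν : POVM H m) {ψ : X → H →L[ℂ] H} (hψ : Measurable ψ) {C : ℝ}
    (hC : ∀ x, ‖ψ x‖ ≤ C) : Integrable (sandwich ν ψ) ν.inducedMeasure := by
  refine (ν.integrable_density.norm.const_mul C).mono'
    (measurable_sandwich ν hψ).aestronglyMeasurable ?_
  filter_upwards [ν.density_nonneg_ae] with x hx
  have hS : ‖CFC.sqrt (ν.density x)‖ * ‖CFC.sqrt (ν.density x)‖ = ‖ν.density x‖ := by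
    rw [← CStarRing.norm_star_mul_self, (CFC.sqrt_nonneg (ν.density x)).isSelfAdjoint.star_eq,
      CFC.sqrt_mul_sqrt_self _ hx]
  calc ‖sandwich ν ψ x‖
      ≤ ‖CFC.sqrt (ν.density x)‖ * ‖ψ x‖ * ‖CFC.sqrt (ν.density x)‖ :=
        (norm_mul_le _ _).trans (mul_le_mul_of_nonneg_right (norm_mul_le _ _) (norm_nonneg _))
    _ = ‖ψ x‖ * ‖ν.density x‖ := by rw [← hS]; ring
    _ ≤ C * ‖ν.density x‖ := mul_le_mul_of_nonneg_right (hC x) (norm_nonneg _)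

/-- Equal integrals over all sets of `F` characterise the ordinary conditional expectation. Only `√D
φ √D` is determined, which is why the final inequality is compressed to the range of `D`. -/
lemma isQCE_iff (ν : POVM H m) {F : MeasurableSpace X} (hF : F ≤ m) {ψ φ : X → H →L[ℂ] H}
    (hψ : Measurable[m] ψ) (hψi : Integrable (sandwich ν ψ) ν.inducedMeasure) :
    IsQCE ν hF ψ φ ↔ Measurable[F] φ ∧
      sandwich (ν.restrict hF) φ =ᵐ[ν.inducedMeasure] ν.inducedMeasure[sandwich ν ψ | F] := by
  have hsm : Measurable[F] φ → StronglyMeasurable[F] (sandwich (ν.restrict hF) φ) := fun hφ =>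
    (measurable_sandwich (ν.restrict hF) hφ).stronglyMeasurable
  have hsetν : ∀ E, MeasurableSet[F] E →
      ∫ x, sandwich ν (E.indicator ψ) x ∂ν.inducedMeasure =
        ∫ x in E, sandwich ν ψ x ∂ν.inducedMeasure := fun E hE => by
    rw [sandwich_indicator, integral_indicator (hF E hE)]
  have hsetF : ∀ E, MeasurableSet[F] E → Measurable[F] φ →
      ∫ x, sandwich (ν.restrict hF) (E.indicator φ) x ∂(ν.restrict hF).inducedMeasure =
        ∫ x in E, sandwich (ν.restrict hF) φ x ∂ν.inducedMeasure := fun E hE hφ => by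
    rw [sandwich_indicator, integral_indicator hE, POVM.inducedMeasure_restrict,
      ← setIntegral_trim hF (hsm hφ) hE]
  constructor
  · rintro ⟨h1, h2, h3⟩
    have hφ := isQRV_iff_measurable.1 h1
    have hint := ((isQIntegrable_iff _ _).1 h2).2
    rw [POVM.inducedMeasure_restrict] at hint
    have hint' := integrable_of_integrable_trim hF hint
    refine ⟨hφ, ae_eq_condExp_of_forall_setIntegral_eq hF hψi (fun s _ _ => hint'.integrableOn)
      (fun E hE _ => ?_) (hsm hφ).aestronglyMeasurable⟩
    obtain ⟨a, ha1, ha2⟩ := h3 E hE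
    rw [← hsetF E hE hφ, ← hsetν E hE, ← ((hasQIntegral_iff _ _ _).1 ha1).2,
      ← ((hasQIntegral_iff _ _ _).1 ha2).2]
  · rintro ⟨hφ, h⟩
    have hint : Integrable (sandwich (ν.restrict hF) φ) (ν.restrict hF).inducedMeasure := by
      rw [POVM.inducedMeasure_restrict]
      exact (integrable_condExp.congr h.symm).trim hF (hsm hφ)
    refine ⟨isQRV_iff_measurable.2 hφ, (isQIntegrable_iff _ _).2 ⟨hφ, hint⟩, fun E hE => ?_⟩
    refine ⟨∫ x, sandwich ν (E.indicator ψ) x ∂ν.inducedMeasure,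
      (hasQIntegral_iff _ _ _).2 ⟨(isQIntegrable_iff _ _).2 ⟨hψ.indicator (hF E hE), ?_⟩, rfl⟩,
      (hasQIntegral_iff _ _ _).2 ⟨(isQIntegrable_iff _ _).2 ⟨hφ.indicator hE, ?_⟩, ?_⟩⟩
    · rw [sandwich_indicator]
      exact hψi.indicator (hF E hE)
    · rw [sandwich_indicator]
      exact hint.indicator hE
    · rw [hsetF E hE hφ, hsetν E hE, ← setIntegral_condExp hF hψi hE]
      exact setIntegral_congr_ae (hF E hE) (h.symm.mono fun x hx _ => hx)

/-- Only almost everywhere: where the density is not positive, its `CFC.sqrt` is `0` by default. -/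
lemma sandwich_one_ae (ν : POVM H m) :
    sandwich ν (fun _ => 1) =ᵐ[ν.inducedMeasure] ν.density := by
  filter_upwards [ν.density_nonneg_ae] with x hx
  rw [sandwich, mul_one, CFC.sqrt_mul_sqrt_self _ hx]

lemma sandwich_mono (ν : POVM H m) {f g : X → H →L[ℂ] H} {x : X} (h : f x ≤ g x) :
    sandwich ν f x ≤ sandwich ν g x :=
  (CFC.sqrt_nonneg (ν.density x)).isSelfAdjoint.conjugate_le_conjugate h

lemma sandwich_sum_smul (ν : POVM H m) {ι : Type*} [Fintype ι] (c : ι → ℝ)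
    (f : ι → X → H →L[ℂ] H) :
    sandwich ν (fun x => ∑ k, c k • f k x) = ∑ k, c k • sandwich ν (f k) := by
  ext1 x
  simp [sandwich, Finset.mul_sum, Finset.sum_mul]

variable (ν : POVM H m) {F : MeasurableSpace X}

lemma condExp_sandwich_one (hF : F ≤ m) :
    ν.inducedMeasure[sandwich ν (fun _ => 1) | F] =ᵐ[ν.inducedMeasure]
      (ν.restrict hF).density :=
  (condExp_congr_ae (sandwich_one_ae ν)).trans (ν.density_restrict_ae_eq_condExp hF).symm

lemma condExp_sandwich_sum_smul {ι : Type*} [Fintype ι] (c : ι → ℝ) (f : ι → X → H →L[ℂ] H)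
    (hf : ∀ k, Integrable (sandwich ν (f k)) ν.inducedMeasure) :
    ν.inducedMeasure[sandwich ν (fun x => ∑ k, c k • f k x) | F] =ᵐ[ν.inducedMeasure]
      fun x => ∑ k, c k • ν.inducedMeasure[sandwich ν (f k) | F] x := by
  rw [sandwich_sum_smul]
  have h1 := condExp_finsetSum (s := Finset.univ) (fun k _ => (hf k).smul (c k)) F
  have h2 := ae_all_iff.2 fun k => condExp_smul (μ := ν.inducedMeasure) (c k) (sandwich ν (f k)) F
  filter_upwards [h1, h2] with x hx1 hx2
  rw [hx1, Finset.sum_apply]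
  exact Finset.sum_congr rfl fun k _ => hx2 k

lemma condExp_sandwich_mono {f g : X → H →L[ℂ] H}
    (hf : Integrable (sandwich ν f) ν.inducedMeasure)
    (hg : Integrable (sandwich ν g) ν.inducedMeasure) (h : ∀ x, f x ≤ g x) :
    ν.inducedMeasure[sandwich ν f | F] ≤ᵐ[ν.inducedMeasure] ν.inducedMeasure[sandwich ν g | F] :=
  condExp_mono hf hg (.of_forall fun x => sandwich_mono ν (h x))

end Sandwich

end OperatorValuedMeasure

/-! ### Existence of versions and conditional partitions -/

section ConditionalExpectation

variable {X : Type*} {H : Type*} [NormedAddCommGroup H] [InnerProductSpace ℂ H]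
  [FiniteDimensional ℂ H] [CompleteSpace H] {m : MeasurableSpace X} (ν : POVM H m)
  {F : MeasurableSpace X}

lemma condExp_sandwich_smul_one (hF : F ≤ m) (C : ℝ) :
    ν.inducedMeasure[sandwich ν (fun _ => C • 1) | F] =ᵐ[ν.inducedMeasure]
      fun x => C • (ν.restrict hF).density x := by
  have h : sandwich ν (fun _ => C • (1 : H →L[ℂ] H)) = C • sandwich ν (fun _ => 1) := by
    ext1 x
    simp [sandwich]
  rw [h]
  filter_upwards [condExp_smul (μ := ν.inducedMeasure) C (sandwich ν (fun _ => 1)) F,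
    condExp_sandwich_one ν hF] with x h1 h2
  rw [h1, Pi.smul_apply, h2]

lemma integrable_sandwich_const (a : H →L[ℂ] H) :
    Integrable (sandwich ν (fun _ => a)) ν.inducedMeasure :=
  integrable_sandwich ν (@measurable_const _ _ _ m a) fun _ => le_rfl

lemma condExp_sandwich_add_smul_one (hF : F ≤ m) {f : X → H →L[ℂ] H}
    (hf : Integrable (sandwich ν f) ν.inducedMeasure) (C : ℝ) :
    ν.inducedMeasure[sandwich ν (fun x => f x + C • 1) | F] =ᵐ[ν.inducedMeasure]
      fun x => ν.inducedMeasure[sandwich ν f | F] x + C • (ν.restrict hF).density x := by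
  have h : sandwich ν (fun x => f x + C • 1) = sandwich ν f + sandwich ν (fun _ => C • 1) := by
    ext1 x
    simp [sandwich, mul_add, add_mul]
  rw [h]
  filter_upwards [condExp_add hf (integrable_sandwich_const ν (C • 1)) F,
    condExp_sandwich_smul_one ν hF C] with x h1 h2
  rw [h1, Pi.add_apply, h2]

lemma density_restrict_nonneg_ae (hF : F ≤ m) :
    ∀ᵐ x ∂ν.inducedMeasure, 0 ≤ (ν.restrict hF).density x := by
  have := (ν.restrict hF).density_nonneg_ae
  rw [POVM.inducedMeasure_restrict] at this
  exact ae_of_ae_trim hF this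

/-- Bounded selfadjoint quantum random variables have quantum conditional expectations. -/
lemma exists_isQCE (hF : F ≤ m) {ψ : X → H →L[ℂ] H} (hψ : Measurable[m] ψ)
    (hsa : ∀ x, IsSelfAdjoint (ψ x)) {C : ℝ} (hC : ∀ x, ‖ψ x‖ ≤ C) :
    ∃ φ, IsQCE ν hF ψ φ := by
  have hint := integrable_sandwich ν hψ hC
  have hupp : ∀ x, ψ x ≤ C • 1 := fun x =>
    (hsa x).le_algebraMap_norm_self.trans <| by
      rw [Algebra.algebraMap_eq_smul_one]
      exact smul_le_smul_of_nonneg_right (hC x) zero_le_one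
  have hlow : ∀ x, (-C) • 1 ≤ ψ x := fun x => le_trans (by
      rw [Algebra.algebraMap_eq_smul_one, neg_smul]
      exact neg_le_neg (smul_le_smul_of_nonneg_right (hC x) zero_le_one))
    (hsa x).neg_algebraMap_norm_le_self
  set D := (ν.restrict hF).density with hD
  set G := ν.inducedMeasure[sandwich ν ψ | F] with hG
  have hDm : Measurable[F] D := (ν.restrict hF).measurable_density
  have hGm : Measurable[F] G := stronglyMeasurable_condExp.measurable
  have hRm : Measurable[F] fun x => cfc (fun t : ℝ => (√t)⁻¹) (D x) :=
    measurable_cfc_inv_sqrt.comp hDm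
  -- The version is the conditioned sandwich `G` conjugated by the generalised inverse of `√D`; the
  -- bounds by `±C • D` ensure that `√D` on both sides restores `G`.
  refine ⟨fun x => cfc (fun t : ℝ => (√t)⁻¹) (D x) * G x * cfc (fun t : ℝ => (√t)⁻¹) (D x),
    (isQCE_iff ν hF hψ hint).2 ⟨(hRm.mul hGm).mul hRm, ?_⟩⟩
  filter_upwards [density_restrict_nonneg_ae ν hF, condExp_sandwich_smul_one ν hF C,
    condExp_sandwich_smul_one ν hF (-C),
    condExp_sandwich_mono (F := F) ν hint (integrable_sandwich_const ν (C • 1)) hupp,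
    condExp_sandwich_mono (F := F) ν (integrable_sandwich_const ν ((-C) • 1)) hint hlow]
    with x h0 h1 h2 h3 h4
  rw [h1] at h3
  rw [h2, neg_smul, neg_le_iff_add_nonneg] at h4
  have hGsa : IsSelfAdjoint (G x) := by
    have := h4.isSelfAdjoint.sub ((IsSelfAdjoint.all C).smul h0.isSelfAdjoint)
    rwa [add_sub_cancel_right] at this
  exact sqrt_mul_invSqrt_conj h0 hGsa h4 h3

variable {α β : ℝ} {ϑ : ℝ → ℝ} {ψ : X → H →L[ℂ] H}

lemma measurable_cfc_comp (hαβ : α ≤ β) (hϑ : ContinuousOn ϑ (Icc α β)) (hψ : Measurable[m] ψ)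
    (hspec : ∀ x, spectrum ℝ (ψ x) ⊆ Icc α β) : Measurable[m] fun x => cfc ϑ (ψ x) := by
  -- Only the values on `[α, β]` matter, so `ϑ` is replaced by its continuous extension by
  -- constants.
  have h : (fun x => cfc ϑ (ψ x)) = fun x => cfc (IccExtend hαβ ((Icc α β).domRestrict ϑ)) (ψ x) :=
    funext fun x => cfc_congr fun t ht => by
      simp [IccExtend_of_mem _ _ (hspec x ht)]
  rw [h]
  exact (measurable_cfc (hϑ.domRestrict.Icc_extend')).comp hψ

lemma exists_norm_cfc_le (hϑ : ContinuousOn ϑ (Icc α β))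
    (hspec : ∀ x, spectrum ℝ (ψ x) ⊆ Icc α β) : ∃ C, ∀ x, ‖cfc ϑ (ψ x)‖ ≤ C := by
  obtain ⟨C, hC⟩ := isCompact_Icc.exists_bound_of_continuousOn hϑ
  exact ⟨max C 0, fun x => norm_cfc_le (le_max_right _ _) fun t ht =>
    (hC t (hspec x ht)).trans (le_max_left _ _)⟩

lemma integrable_sandwich_cfc (hαβ : α ≤ β) (hϑ : ContinuousOn ϑ (Icc α β))
    (hψ : Measurable[m] ψ) (hspec : ∀ x, spectrum ℝ (ψ x) ⊆ Icc α β) :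
    Integrable (sandwich ν fun x => cfc ϑ (ψ x)) ν.inducedMeasure := by
  obtain ⟨C, hC⟩ := exists_norm_cfc_le hϑ hspec
  exact integrable_sandwich ν (measurable_cfc_comp hαβ hϑ hψ hspec) hC

/-- Conditioning `ψ` through a partition of unity of its spectrum yields, almost everywhere, a
finite positive operator valued measure with barycentre the conditional expectation of `ψ`. -/
lemma ae_exists_conditional_partition (hF : F ≤ m) (hαβ : α ≤ β) (hϑ : ContinuousOn ϑ (Icc α β))
    (hψ : Measurable[m] ψ) (hsa : ∀ x, IsSelfAdjoint (ψ x))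
    (hspec : ∀ x, spectrum ℝ (ψ x) ⊆ Icc α β) {ε : ℝ} (hε : 0 < ε) :
    ∀ᵐ x ∂ν.inducedMeasure, ∃ (N : ℕ) (c : Fin N → ℝ) (G : Fin N → H →L[ℂ] H),
      (∀ k, c k ∈ Icc α β) ∧ (∀ k, 0 ≤ G k) ∧ ∑ k, G k = (ν.restrict hF).density x ∧
      ∑ k, c k • G k = ν.inducedMeasure[sandwich ν ψ | F] x ∧
      ∑ k, ϑ (c k) • G k ≤ ν.inducedMeasure[sandwich ν (fun x => cfc ϑ (ψ x)) | F] x +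
        ε • (ν.restrict hF).density x := by
  obtain ⟨N, c, h, hc, hcont, hnn, hsum, hmean, happ⟩ :=
    exists_partition_of_unity_approx hαβ hϑ hε
  have hco : ∀ (f : ℝ → ℝ) x, ContinuousOn f (spectrum ℝ (ψ x)) := fun f x =>
    continuousOn_real_spectrum f (ψ x)
  have hint : ∀ k, Integrable (sandwich ν fun x => cfc (h k) (ψ x)) ν.inducedMeasure := fun k =>
    integrable_sandwich_cfc ν hαβ (hcont k).continuousOn hψ hspec
  have hintϑ := integrable_sandwich_cfc ν hαβ hϑ hψ hspec
  have hlin : ∀ (a : Fin N → ℝ) x,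
      ∑ k, a k • cfc (h k) (ψ x) = cfc (fun t => ∑ k, a k * h k t) (ψ x) := fun a x => by
    have hfun : (fun t => ∑ k, a k * h k t) = ∑ k, fun t => a k * h k t := by
      ext t
      rw [Finset.sum_apply]
    rw [hfun, cfc_sum_univ (fun k t => a k * h k t) (ψ x) fun k => hco _ x]
    exact Finset.sum_congr rfl fun k _ => (cfc_const_mul (a k) (h k) (ψ x) (hco _ x)).symm
  have hone : (fun x => ∑ k, (1 : ℝ) • cfc (h k) (ψ x)) = fun _ => 1 := by
    ext1 x
    rw [hlin]
    simp only [one_mul, hsum]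
    exact cfc_const_one ℝ (ψ x)
  -- The exact mean of the partition makes this an equality, with no error term for `ψ`.
  have hid : (fun x => ∑ k, c k • cfc (h k) (ψ x)) = ψ := by
    ext1 x
    rw [hlin, cfc_congr fun t ht => hmean t (hspec x ht)]
    exact cfc_id' ℝ (ψ x) (hsa x)
  have hle : ∀ x, ∑ k, ϑ (c k) • cfc (h k) (ψ x) ≤ cfc ϑ (ψ x) + ε • 1 := fun x => by
    have hadd : cfc (fun t => ϑ t + ε) (ψ x) = cfc ϑ (ψ x) + ε • 1 := by
      rw [cfc_add_const ε ϑ (ψ x) (hco _ x) (hsa x), Algebra.algebraMap_eq_smul_one]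
    rw [hlin, ← hadd]
    exact cfc_mono (fun t ht => happ t (hspec x ht)) (hco _ x) (hco _ x)
  have hE1 := condExp_sandwich_sum_smul (F := F) ν (fun _ => (1 : ℝ)) _ hint
  have hE2 := condExp_sandwich_sum_smul (F := F) ν c _ hint
  have hE3 := condExp_sandwich_sum_smul (F := F) ν (fun k => ϑ (c k)) _ hint
  rw [hone] at hE1
  rw [hid] at hE2
  have hpos : ∀ᵐ x ∂ν.inducedMeasure, ∀ k,
      0 ≤ ν.inducedMeasure[sandwich ν fun x => cfc (h k) (ψ x) | F] x := by
    refine ae_all_iff.2 fun k => condExp_nonneg (.of_forall fun x => ?_)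
    have h0 : 0 ≤ cfc (h k) (ψ x) := cfc_nonneg fun t _ => hnn k t
    exact (CFC.sqrt_nonneg (ν.density x)).isSelfAdjoint.conjugate_nonneg h0
  have hintsum : Integrable (sandwich ν fun x => ∑ k, ϑ (c k) • cfc (h k) (ψ x))
      ν.inducedMeasure := by
    rw [sandwich_sum_smul]
    exact integrable_finsetSum' _ fun k _ => (hint k).smul (ϑ (c k))
  have hintadd : Integrable (sandwich ν fun x => cfc ϑ (ψ x) + ε • 1) ν.inducedMeasure := by
    refine (hintϑ.add (integrable_sandwich_const ν (ε • 1))).congr (.of_forall fun x => ?_)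
    simp [sandwich, mul_add, add_mul]
  filter_upwards [hE1, hE2, hE3, hpos, condExp_sandwich_one ν hF,
    condExp_sandwich_add_smul_one ν hF hintϑ ε,
    condExp_sandwich_mono (F := F) ν hintsum hintadd hle] with x h1 h2 h3 h4 h5 h6 h7
  refine ⟨N, c, fun k => ν.inducedMeasure[sandwich ν fun x => cfc (h k) (ψ x) | F] x, hc, h4,
    ?_, h2.symm, ?_⟩
  · rw [← h5, h1]
    simp only [one_smul]
  · rw [← h6, ← h3]
    exact h7

end ConditionalExpectation

end QuantumProb

end

/-! ### The quantum conditional Jensen inequality -/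

theorem mainTheorem7 {X : Type*} [TopologicalSpace X] [LocallyCompactSpace X] [T2Space X]
    [mX : MeasurableSpace X] [BorelSpace X]
    {H : Type*} [NormedAddCommGroup H] [InnerProductSpace ℂ H] [FiniteDimensional ℂ H]
    [CompleteSpace H]
    (ν : QuantumProb.POVM H mX) (hν : ν.IsProbability)
    (F : MeasurableSpace X) (hF : F ≤ mX)
    (J : Set ℝ) (hJ_open : IsOpen J) (hJ_interval : J.OrdConnected)
    (α β : ℝ) (hαβ : α ≤ β) (hJ : Set.Icc α β ⊆ J)
    (ψ : X → H →L[ℂ] H) (hψ : QuantumProb.IsQRV mX ψ)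
    (hψ_sa : ∀ x, IsSelfAdjoint (ψ x)) (hψ_spec : ∀ x, spectrum ℝ (ψ x) ⊆ Set.Icc α β)
    (ϑ : ℝ → ℝ) (hϑ : QuantumProb.OperatorConvexOn J ϑ) :
    (∃ φ, QuantumProb.IsQCE ν hF ψ φ) ∧
    (∃ ω, QuantumProb.IsQCE ν hF (fun x => cfc ϑ (ψ x)) ω) ∧
    ∀ φ ω : X → H →L[ℂ] H, QuantumProb.IsQCE ν hF ψ φ →
      QuantumProb.IsQCE ν hF (fun x => cfc ϑ (ψ x)) ω →
      -- on the range of the density of the restriction of `ν` to `F`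
      (∀ᵐ x ∂ν.inducedMeasure, ∀ (k : ℕ) (v : EuclideanSpace ℂ (Fin k) →ₗᵢ[ℂ] H),
        LinearMap.range v.toLinearMap = LinearMap.range ((ν.restrict hF).density x).toLinearMap →
        IsSelfAdjoint (QuantumProb.compress v (φ x)) ∧
        spectrum ℝ (QuantumProb.compress v (φ x)) ⊆ Set.Icc α β ∧
        cfc ϑ (QuantumProb.compress v (φ x)) ≤ QuantumProb.compress v (ω x)) ∧
      -- on `H` itself, wherever that density is invertible
      (∀ᵐ x ∂ν.inducedMeasure, IsUnit ((ν.restrict hF).density x) →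
        IsSelfAdjoint (φ x) ∧ spectrum ℝ (φ x) ⊆ Set.Icc α β ∧
        cfc ϑ (φ x) ≤ ω x) := by
  have hψm : Measurable[mX] ψ := QuantumProb.isQRV_iff_measurable.1 hψ
  have hcont : ContinuousOn ϑ (Icc α β) :=
    ((hϑ.convexOn hJ_interval).continuousOn hJ_open).mono hJ
  have hψϑm := QuantumProb.measurable_cfc_comp hαβ hcont hψm hψ_spec
  -- Viewing `ψ` as the functional calculus of the identity lets the bounds proved for `ϑ` serve for
  -- `ψ` too.
  have hid : ∀ x, cfc (fun t : ℝ => t) (ψ x) = ψ x := fun x => cfc_id' ℝ (ψ x) (hψ_sa x)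
  have hψi := QuantumProb.integrable_sandwich_cfc ν hαβ (continuousOn_id' _) hψm hψ_spec
  obtain ⟨C, hC⟩ := QuantumProb.exists_norm_cfc_le (ψ := ψ) (continuousOn_id' _) hψ_spec
  simp only [hid] at hψi hC
  have hψϑi := QuantumProb.integrable_sandwich_cfc ν hαβ hcont hψm hψ_spec
  obtain ⟨C', hC'⟩ := QuantumProb.exists_norm_cfc_le (ψ := ψ) hcont hψ_spec
  refine ⟨QuantumProb.exists_isQCE ν hF hψm hψ_sa hC,
    QuantumProb.exists_isQCE ν hF hψϑm (fun x => cfc_predicate _ _) hC', fun φ ω hφ hω => ?_⟩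
  have hφ' := ((QuantumProb.isQCE_iff ν hF hψm hψi).1 hφ).2
  have hω' := ((QuantumProb.isQCE_iff ν hF hψϑm hψϑi).1 hω).2
  -- The errors `1 / (n + 1)` form a countable family, so one null set serves for all of them.
  have key : ∀ᵐ x ∂ν.inducedMeasure, ∀ n : ℕ, _ := ae_all_iff.2 fun n =>
    QuantumProb.ae_exists_conditional_partition ν hF hαβ hcont hψm hψ_sa hψ_spec
      (ε := 1 / (n + 1 : ℝ)) (by positivity)
  constructor
  · filter_upwards [hφ', hω', key, QuantumProb.density_restrict_nonneg_ae ν hF]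
      with x h1 h2 h3 h4 k v hv
    rw [← h1, ← h2] at h3
    refine hϑ.jensen_on_range hJ h4 h3 v.toContinuousLinearMap ?_ hv.le
    ext1 y
    refine ext_inner_left ℂ fun z => ?_
    rw [ContinuousLinearMap.comp_apply, ContinuousLinearMap.adjoint_inner_right]
    exact v.inner_map_map z y
  · filter_upwards [hφ', hω', key, QuantumProb.density_restrict_nonneg_ae ν hF]
      with x h1 h2 h3 h4 hu
    rw [← h1, ← h2] at h3
    have hadj : ContinuousLinearMap.adjoint (ContinuousLinearMap.id ℂ H) =
        ContinuousLinearMap.id ℂ H := star_one (H →L[ℂ] H)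
    -- An invertible density has full range, so the identity is an admissible isometry.
    have h := hϑ.jensen_on_range hJ h4 h3 (ContinuousLinearMap.id ℂ H) (by rw [hadj]; rfl) ?_
    · simpa only [hadj, ContinuousLinearMap.id_comp, ContinuousLinearMap.comp_id] using h
    · obtain ⟨u, hu⟩ := hu
      rw [← hu]
      rintro y -
      refine ⟨(↑u⁻¹ : H →L[ℂ] H) y, ?_⟩
      exact congrArg (fun T : H →L[ℂ] H => T y) u.mul_inv
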